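/- **Theorem (von Neumann entropy estimation).** Let $\rho$ be a state (density matrix) on an $n$-qubit system $A$. A purified query oracle of $\rho$ is a unitary $U_\rho$ on $A$ and a further $m$-qubit system $B$ such that $|\Psi_\rho\rangle = U_\rho|0\rangle_A|0\rangle_B$ satisfies $\operatorname{tr}_B|\Psi_\rho\rangle\langle\Psi_\rho| = \rho$. Let $S(\rho) = -\operatorname{tr}(\rho\ln\rho)$ be the von Neumann entropy. A *circuit* here starts in $|0\cdots0\rangle$ on $A$, $B$ and any number of ancilla qubits, and alternates queries to $U_\rho$ or $U_\rho^\dagger$ with unitary gates that do not depend on $\rho$ or $U_\rho$; one ancilla qubit is measured at its end in the computational basis. Write $\log^+ x = \max\{0,\ln x\}$ for $x > 0$ and $\log^+ 0 = 0$. For every $\delta\in(0,1)$ there is a constant $C>0$, depending only on $\delta$, such that for all $n, m\in\mathbb{N}$, $0<\gamma\le 1$ and $\varepsilon>0$ the following holds. 1. There is an algorithm, depending only on $n,m,\gamma,\varepsilon,\delta$, that runs one fixed circuit a fixed number of times independently, measures a single qubit in each run, and computes from the measured bits a number $E$, with the following property. For every $n$-qubit state $\rho$ whose nonzero eigenvalues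 are all at least $\gamma$, and every purified query oracle $U_\rho$ of $\rho$ with $m$-qubit system $B$, we have $|E-S(\rho)|\le\varepsilon$ with probability at least $1-\delta$. The total number of queries to $U_\rho$ and $U_\rho^\dagger$ is at most $$C\cdot\frac{1}{\gamma\varepsilon^2}\,\ln^2\!\Big(\frac1\gamma\Big)\,\log^+\!\Big(\frac{\ln(1/\gamma)}{\varepsilon}\Big).$$ 2. If the algorithm may choose the circuit of each run (always on fresh registers, always measuring a single qubit) depending on the earlier outcomes, as in iterative amplitude estimation, then the same guarantee can be reached with a total number of queries to $U_\rho$ and $U_\rho^\dagger$ that is, for all measurement outcomes, at most $$C\cdot\frac{1}{\gamma\varepsilon}\,\ln\!\Big(\frac1\gamma\Big)\,\log^+\!\Big(\frac{\ln(1/\gamma)}{\varepsilon}\Big).$$ -/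

import Mathlib

open scoped Kronecker ComplexOrder

noncomputable section

namespace QEntropy

/-- Labels of the computational basis of a register of `n` qubits. -/
abbrev Qubits (n : ℕ) : Type := Fin n → Fin 2

/-- The set of unitary operators on the Hilbert space with orthonormal basis `ι`. -/
abbrev Unitaries (ι : Type) [Fintype ι] [DecidableEq ι] : Type := ↥(Matrix.unitaryGroup ι ℂ)

/-- The computational basis state `|0…0⟩`. -/
def zeroState (ι : Type) [DecidableEq ι] [Zero ι] : ι → ℂ := Pi.single 0 1

/-! ### States, entropy, purified query oracles -/

/-- `ρ` is a quantum state (density matrix). -/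
def IsDensityMatrix {ι : Type} [Fintype ι] (ρ : Matrix ι ι ℂ) : Prop :=
  ρ.PosSemidef ∧ ρ.trace = 1

/-- Every nonzero eigenvalue of (the Hermitian matrix) `ρ` is at least `γ`. -/
def NonzeroEigenvaluesGE {ι : Type} [Fintype ι] [DecidableEq ι]
    (ρ : Matrix ι ι ℂ) (γ : ℝ) : Prop :=
  ∀ p : ℝ, p ≠ 0 → Module.End.HasEigenvalue (Matrix.toLin' ρ) (p : ℂ) → γ ≤ p

/-- The von Neumann entropy `S(ρ) = - tr (ρ ln ρ)`. The logarithm of `ρ` is taken with the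
functional calculus; as `Real.log 0 = 0`, the usual convention `0 ln 0 = 0` is respected. -/
def vonNeumannEntropy {ι : Type} [Fintype ι] [DecidableEq ι] (ρ : Matrix ι ι ℂ) : ℝ :=
  -(Matrix.trace (ρ * cfc Real.log ρ)).re

/-- The partial trace over `B` of the rank-one operator `|Ψ⟩⟨Ψ|` on `A ⊗ B`. -/
def reducedState {α β : Type} [Fintype β] (Ψ : α × β → ℂ) : Matrix α α ℂ :=
  fun i j => ∑ b, Ψ (i, b) * star (Ψ (j, b))

/-- `U` is a purified query oracle of `ρ`: the state `U |0⟩_A |0⟩_B` is a purification of `ρ`.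
The register `A` has `n` qubits and the purifying register `B` has `m` qubits. -/
def IsPurifiedQueryOracle {n m : ℕ} (U : Unitaries (Qubits n × Qubits m))
    (ρ : Matrix (Qubits n) (Qubits n) ℂ) : Prop :=
  reducedState (U.1.mulVec (zeroState (Qubits n × Qubits m))) = ρ

/-! ### Quantum query circuits in which a single qubit is measured -/

/-- The whole register of a circuit: the systems `A` and `B` on which the oracle acts, and
`w + 1` further ancilla qubits. -/
abbrev Register (n m w : ℕ) : Type := (Qubits n × Qubits m) × Qubits (w + 1)

/-- A quantum circuit with oracle access to a unitary `U` on `n + m` qubits and to `U†`.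
The circuit starts in `|0…0⟩`, applies the gate `start`, and then for each entry
`(d, V)` of `layers` first one query (`U` if `d = false`, `U†` if `d = true`) and then the gate
`V`. The gates are unitaries on the whole register that do not depend on the oracle. -/
structure QueryCircuit (n m : ℕ) where
  w : ℕ
  start : Unitaries (Register n m w)
  layers : List (Bool × Unitaries (Register n m w))

namespace QueryCircuit

variable {n m : ℕ}

/-- The number of queries to `U` and `U†` in one execution of the circuit. -/
def queries (c : QueryCircuit n m) : ℕ := c.layers.length

/-- One query: `U` or `U†` on the registers `A` and `B`, the identity on the ancilla qubits. -/
def query (w : ℕ) (U : Unitaries (Qubits n × Qubits m)) (dagger : Bool) :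
    Matrix (Register n m w) (Register n m w) ℂ :=
  (if dagger then U.1.conjTranspose else U.1) ⊗ₖ (1 : Matrix (Qubits (w + 1)) (Qubits (w + 1)) ℂ)

/-- The state of the register at the end of the circuit, before the measurement. -/
def finalState (c : QueryCircuit n m) (U : Unitaries (Qubits n × Qubits m)) :
    Register n m c.w → ℂ :=
  c.layers.foldl (fun ψ l => l.2.1.mulVec ((query c.w U l.1).mulVec ψ))
    (c.start.1.mulVec (zeroState (Register n m c.w)))

/-- Born rule: the probability that measuring the first ancilla qubit in the computational basis
at the end of the circuit gives the outcome `b`. -/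
def outcomeProb (c : QueryCircuit n m) (U : Unitaries (Qubits n × Qubits m)) (b : Fin 2) : ℝ :=
  ∑ x : Register n m c.w, if x.2 0 = b then ‖c.finalState U x‖ ^ 2 else 0

end QueryCircuit

/-! ### Algorithms -/

/-- An algorithm by plain repetition of a single-qubit measurement: one fixed circuit is executed
`shots` times independently, its first ancilla qubit is measured each time, and a real number is
computed from the measured bits. -/
structure SamplingAlgorithm (n m : ℕ) where
  circuit : QueryCircuit n m
  shots : ℕ
  estimate : (Fin shots → Fin 2) → ℝ

namespace SamplingAlgorithm

variable {n m : ℕ}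

/-- The total number of queries to `U` and `U†`. -/
def queries (P : SamplingAlgorithm n m) : ℕ := P.shots * P.circuit.queries

open Classical in
/-- The probability that the output lies in `s`. -/
def outputProb (P : SamplingAlgorithm n m) (U : Unitaries (Qubits n × Qubits m))
    (s : Set ℝ) : ℝ :=
  ∑ b : Fin P.shots → Fin 2,
    if P.estimate b ∈ s then ∏ i, P.circuit.outcomeProb U (b i) else 0

end SamplingAlgorithm

/-- An adaptive algorithm (as in iterative amplitude estimation): it either stops with an output,
or executes a circuit on a fresh register, measures the first ancilla qubit, and continues
depending on the outcome. -/
inductive AdaptiveAlgorithm (n m : ℕ) : Type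
  | output (r : ℝ) : AdaptiveAlgorithm n m
  | run (c : QueryCircuit n m) (next : Fin 2 → AdaptiveAlgorithm n m) : AdaptiveAlgorithm n m

namespace AdaptiveAlgorithm

variable {n m : ℕ}

/-- The total number of queries to `U` and `U†`, in the worst case over measurement outcomes. -/
def queries : AdaptiveAlgorithm n m → ℕ
  | output _ => 0
  | run c next => c.queries + max (queries (next 0)) (queries (next 1))

open Classical in
/-- The probability that the output lies in `s`. -/
def outputProb (U : Unitaries (Qubits n × Qubits m)) (s : Set ℝ) :
    AdaptiveAlgorithm n m → ℝ
  | output r => if r ∈ s then 1 else 0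
  | run c next => ∑ b : Fin 2, c.outcomeProb U b * outputProb U s (next b)

end AdaptiveAlgorithm

end QEntropy

end

/-! ### Circuits as operator families with a query count -/

namespace QEntropy

open Matrix

/-! The eigenvalues p of ρ, each taken with probability p, form the spectral distribution, and S(ρ)
is the mean of -ln p under it. The plan is a circuit whose measured bit has a probability that is,
up to a small error, an affine function of this mean.

The Hermitian unitary U†·SWAP·U block-encodes ρ. Composed with a reflection about |0⟩ it gives a
walk W whose powers have the Chebyshev matrix elements Σ p cos(jθ), where cos θ = p
(`walkMoment_withEigenvalues`). On the prepared purification, W therefore acts as a random phase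
e^{±iθ}, each sign having weight p/2. A vector-valued polynomial of degree d with unit norm on the
circle can be applied to W with 2d queries (`exists_realizes_polynomial`). The ancilla may have any
dimension, so no Fejér–Riesz factorization is needed: if g and 1 - g are sums of squared moduli of
polynomials, these polynomials are the entries of such a vector, and g becomes a coin bias
(`exists_realizes_coin`).

It remains to find a certified g of degree O(l/γ), bounded by O(1 + ln(1/γ)), that equals -ln Re z
plus a constant up to O(e^{-l}) wherever Re z ≥ γ (`exists_coin_neg_log`). With ζ = -z² one has |1 -
ζ| = 2|Re z|. The logarithmic series of 1 - rζ, damped by r = 1 - γ, has coefficient sum at most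
ln(1/γ). The discrepancy between damped and undamped factor is carried by a bias q ≥ 1/16, whose
logarithm is a bounded expectation over coin tosses, and by one rapidly converging series.

Plain repetition and Chebyshev's inequality give the first bound. For the second, an interval search
amplifies the deviation of the bias from the current midpoint (`exists_adaptive_search`); shot
numbers decay geometrically over the stages, so costs and failure probabilities are both geometric
sums. Taking l of order ln(ln(1/γ)/ε) yields the logarithmic factor. If ln(1/γ) ≤ 2ε or γ > 1/2, a
constant output needs no query. -/

/-- The systems `A` and `B` on which the oracle acts. -/
abbrev Sys (n m : ℕ) : Type := Qubits n × Qubits m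

/-- The oracle `U` (or `U†`) tensored with the identity of a workspace `Y`. -/
def oracleOp {n m : ℕ} (Y : Type) [DecidableEq Y] (U : Unitaries (Sys n m)) (dagger : Bool) :
    Matrix (Sys n m × Y) (Sys n m × Y) ℂ :=
  (if dagger then U.1.conjTranspose else U.1) ⊗ₖ (1 : Matrix Y Y ℂ)

/-- `F U` is a product of gates that do not depend on `U` and of exactly `d` queries. -/
inductive Realizes {n m : ℕ} (Y : Type) [Fintype Y] [DecidableEq Y] :
    ℕ → (Unitaries (Sys n m) → Matrix (Sys n m × Y) (Sys n m × Y) ℂ) → Prop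
  | gate (V : Unitaries (Sys n m × Y)) : Realizes Y 0 (fun _ => V.1)
  | step {d : ℕ} {F : Unitaries (Sys n m) → Matrix (Sys n m × Y) (Sys n m × Y) ℂ} (b : Bool)
      (V : Unitaries (Sys n m × Y)) (h : Realizes Y d F) :
      Realizes Y (d + 1) (fun U => V.1 * (oracleOp Y U b * F U))

theorem oracleOp_mem {n m : ℕ} (Y : Type) [Fintype Y] [DecidableEq Y] (U : Unitaries (Sys n m))
    (b : Bool) : oracleOp Y U b ∈ unitaryGroup (Sys n m × Y) ℂ := by
  unfold oracleOp
  refine kronecker_mem_unitary ?_ (one_mem _)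
  cases b
  · exact U.2
  · exact Unitary.star_mem U.2

theorem oracleOp_conjTranspose {n m : ℕ} (Y : Type) [Fintype Y] [DecidableEq Y]
    (U : Unitaries (Sys n m)) (b : Bool) : (oracleOp Y U b)ᴴ = oracleOp Y U (!b) := by
  cases b <;> simp [oracleOp, conjTranspose_kronecker]

namespace Realizes

variable {n m : ℕ} {Y : Type} [Fintype Y] [DecidableEq Y]
  {F F₁ F₂ : Unitaries (Sys n m) → Matrix (Sys n m × Y) (Sys n m × Y) ℂ} {d d₁ d₂ : ℕ}

theorem mem_unitary (h : Realizes Y d F) (U : Unitaries (Sys n m)) :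
    F U ∈ unitaryGroup (Sys n m × Y) ℂ := by
  induction h with
  | gate V => exact V.2
  | step b V _ ih => exact mul_mem V.2 (mul_mem (oracleOp_mem Y U b) ih)

theorem gate_mul (V : Matrix (Sys n m × Y) (Sys n m × Y) ℂ)
    (hV : V ∈ unitaryGroup (Sys n m × Y) ℂ) (h : Realizes Y d F) :
    Realizes Y d (fun U => V * F U) := by
  cases h with
  | gate W => exact gate (⟨V, hV⟩ * W)
  | step b W h =>
    have := step b (⟨V, hV⟩ * W) h
    simpa [Matrix.mul_assoc] using this

theorem query_mul (b : Bool) (h : Realizes Y d F) :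
    Realizes Y (d + 1) (fun U => oracleOp Y U b * F U) := by
  simpa using step b 1 h

theorem mul (h₂ : Realizes Y d₂ F₂) (h₁ : Realizes Y d₁ F₁) :
    Realizes Y (d₂ + d₁) (fun U => F₂ U * F₁ U) := by
  induction h₂ with
  | gate V => simpa using h₁.gate_mul V.1 V.2
  | step b V _ ih =>
    have := step b V ih
    simpa [Matrix.mul_assoc, add_right_comm] using this

theorem one : Realizes Y 0 (fun _ : Unitaries (Sys n m) => 1) := gate 1

theorem conjTranspose (h : Realizes Y d F) : Realizes Y d (fun U => (F U)ᴴ) := by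
  induction h with
  | gate V => exact gate (star V)
  | @step d F b V _ ih =>
    have h1 : Realizes Y 1
        (fun U : Unitaries (Sys n m) => oracleOp Y U (!b) * (V.1)ᴴ) := query_mul (!b) (gate (star V))
    have := ih.mul h1
    simpa [Matrix.mul_assoc, oracleOp_conjTranspose] using this

theorem pow (h : Realizes Y d F) (k : ℕ) : Realizes Y (k * d) (fun U => F U ^ k) := by
  induction k with
  | zero => simpa using one
  | succ k ih =>
    have := h.mul ih
    simpa [pow_succ', Nat.succ_mul, add_comm] using this

/-- The constructions use a structured workspace `Y`, whereas a circuit needs qubits; conjugating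
every gate by the relabelling `e` passes from one to the other, and queries are unaffected because
they act trivially on `Y`. -/
theorem exists_layers {w : ℕ} (e : Qubits (w + 1) ≃ Y) (h : Realizes Y d F) :
    ∃ (start : Unitaries (Register n m w)) (layers : List (Bool × Unitaries (Register n m w))),
      layers.length = d ∧ ∀ (U : Unitaries (Sys n m)) (ψ : Register n m w → ℂ),
        layers.foldl (fun ψ l => l.2.1.mulVec ((QueryCircuit.query w U l.1).mulVec ψ))
          (start.1.mulVec ψ) =
        ((F U).submatrix ((Equiv.refl _).prodCongr e) ((Equiv.refl _).prodCongr e)).mulVec ψ := by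
  have hgate : ∀ V : Unitaries (Sys n m × Y),
      V.1.submatrix ((Equiv.refl _).prodCongr e) ((Equiv.refl _).prodCongr e) ∈
        unitaryGroup (Register n m w) ℂ := by
    intro V
    rw [mem_unitaryGroup_iff, star_eq_conjTranspose, conjTranspose_submatrix,
      submatrix_mul_equiv, ← star_eq_conjTranspose, mem_unitaryGroup_iff.mp V.2]
    exact submatrix_one_equiv _
  have hq : ∀ (U : Unitaries (Sys n m)) (b : Bool),
      (oracleOp Y U b).submatrix ((Equiv.refl _).prodCongr e) ((Equiv.refl _).prodCongr e) =
        QueryCircuit.query w U b := by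
    intro U b
    ext ⟨i, x⟩ ⟨j, y⟩
    simp [oracleOp, QueryCircuit.query, kroneckerMap_apply, one_apply]
  induction h with
  | gate V => exact ⟨⟨_, hgate V⟩, [], rfl, fun U ψ => rfl⟩
  | step b V _ ih =>
    obtain ⟨s, l, hl, hs⟩ := ih
    refine ⟨s, l ++ [(b, ⟨_, hgate V⟩)], by simp [hl], fun U ψ => ?_⟩
    rw [List.foldl_append, hs]
    simp only [List.foldl_cons, List.foldl_nil]
    rw [← hq, mulVec_mulVec, mulVec_mulVec, submatrix_mul_equiv, submatrix_mul_equiv,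
      Matrix.mul_assoc]

/-- A realizable family of operators gives a circuit in which a prescribed bit of the workspace is
measured. -/
theorem exists_circuit {w : ℕ} (e : Qubits (w + 1) ≃ Y) (bit : Y → Fin 2)
    (hbit : ∀ x, bit (e x) = x 0) (h : Realizes Y d F) :
    ∃ c : QueryCircuit n m, c.queries = d ∧ ∀ U b,
      c.outcomeProb U b = ∑ x : Sys n m × Y,
        if bit x.2 = b then ‖(F U).mulVec (Pi.single (0, e 0) 1) x‖ ^ 2 else 0 := by
  obtain ⟨s, l, hl, hs⟩ := h.exists_layers e
  refine ⟨⟨w, s, l⟩, hl, fun U b => ?_⟩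
  unfold QueryCircuit.outcomeProb QueryCircuit.finalState
  rw [hs]
  refine Fintype.sum_equiv ((Equiv.refl _).prodCongr e) _ _ fun x => ?_
  have : ((F U).submatrix ((Equiv.refl _).prodCongr e) ((Equiv.refl _).prodCongr e)).mulVec
      (zeroState (Register n m w)) x =
      (F U).mulVec (Pi.single (0, e 0) 1) (((Equiv.refl _).prodCongr e) x) := by
    simp only [zeroState, mulVec_single_one]
    rfl
  rw [this]
  simp [hbit]

end Realizes

theorem QueryCircuit.outcomeProb_nonneg {n m : ℕ} (c : QueryCircuit n m) (U : Unitaries (Sys n m))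
    (b : Fin 2) : 0 ≤ c.outcomeProb U b :=
  Finset.sum_nonneg fun x _ => by split_ifs <;> positivity

end QEntropy

namespace QEntropy

open Matrix

/-! ### Controlled operators and basic unitaries -/

section Tensor

variable {α G : Type}

/-- The product vector on `α × (α × G)` of a vector on `α × α` and a vector on `G`. -/
def tens (χ : α × α → ℂ) (v : G → ℂ) : α × (α × G) → ℂ :=
  fun x => χ (x.1, x.2.1) * v x.2.2

/-- The product operator on `α × (α × G)`. -/
def tensOp (S : Matrix (α × α) (α × α) ℂ) (E : Matrix G G ℂ) :
    Matrix (α × (α × G)) (α × (α × G)) ℂ :=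
  (S ⊗ₖ E).submatrix (Equiv.prodAssoc _ _ _).symm (Equiv.prodAssoc _ _ _).symm

theorem tens_add_right (χ : α × α → ℂ) (v w : G → ℂ) : tens χ (v + w) = tens χ v + tens χ w := by
  ext x; simp [tens, mul_add]

theorem tens_zero_right (χ : α × α → ℂ) : tens χ (0 : G → ℂ) = 0 := by
  ext x; simp [tens]

theorem tensOp_conjTranspose (S : Matrix (α × α) (α × α) ℂ) (E : Matrix G G ℂ) :
    (tensOp S E)ᴴ = tensOp Sᴴ Eᴴ := by
  simp [tensOp, conjTranspose_submatrix, conjTranspose_kronecker]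

theorem tensOp_one [DecidableEq α] [DecidableEq G] :
    tensOp (1 : Matrix (α × α) (α × α) ℂ) (1 : Matrix G G ℂ) = 1 := by
  rw [tensOp, one_kronecker_one]
  exact submatrix_one_equiv _

theorem tensOp_add_right (S : Matrix (α × α) (α × α) ℂ) (E E' : Matrix G G ℂ) :
    tensOp S (E + E') = tensOp S E + tensOp S E' := by
  ext x y; simp [tensOp, mul_add]

theorem tensOp_zero_right (S : Matrix (α × α) (α × α) ℂ) :
    tensOp S (0 : Matrix G G ℂ) = 0 := by
  ext x y; simp [tensOp]

variable [Fintype α] [Fintype G]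

theorem tensOp_mul (S S' : Matrix (α × α) (α × α) ℂ) (E E' : Matrix G G ℂ) :
    tensOp S E * tensOp S' E' = tensOp (S * S') (E * E') := by
  rw [tensOp, tensOp, submatrix_mul_equiv, ← mul_kronecker_mul, tensOp]

theorem tensOp_mulVec (S : Matrix (α × α) (α × α) ℂ) (E : Matrix G G ℂ) (χ : α × α → ℂ)
    (v : G → ℂ) : tensOp S E *ᵥ tens χ v = tens (S *ᵥ χ) (E *ᵥ v) := by
  ext x
  simp only [mulVec, dotProduct, tensOp, tens, submatrix_apply, kroneckerMap_apply,
    Finset.sum_mul_sum]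
  rw [← Fintype.sum_prod_type' (f := fun (i : α × α) (j : G) =>
      S (x.1, x.2.1) i * χ i * (E x.2.2 j * v j))]
  refine Fintype.sum_equiv (Equiv.prodAssoc _ _ _).symm _ _ fun y => ?_
  simp only [Equiv.prodAssoc_symm_apply]
  ring

variable [DecidableEq α] [DecidableEq G]

/-- The operator `S` controlled by the projector `E`. -/
def controlled (E : Matrix G G ℂ) (S : Matrix (α × α) (α × α) ℂ) :
    Matrix (α × (α × G)) (α × (α × G)) ℂ :=
  tensOp S E + tensOp 1 (1 - E)

theorem controlled_mul {E : Matrix G G ℂ} (hE : E * E = E) (S S' : Matrix (α × α) (α × α) ℂ) :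
    controlled E S * controlled E S' = controlled E (S * S') := by
  simp [controlled, add_mul, mul_add, tensOp_mul, mul_sub, sub_mul, hE, tensOp_zero_right]

theorem controlled_mem {E : Matrix G G ℂ} (hE : E * E = E) (hE' : Eᴴ = E)
    {S : Matrix (α × α) (α × α) ℂ} (hS : S ∈ unitaryGroup (α × α) ℂ) :
    controlled E S ∈ unitaryGroup (α × (α × G)) ℂ := by
  have h1 : star (controlled E S) = controlled E Sᴴ := by
    simp [controlled, star_eq_conjTranspose, tensOp_conjTranspose, hE']
  rw [mem_unitaryGroup_iff, h1, controlled_mul hE, ← star_eq_conjTranspose,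
    mem_unitaryGroup_iff.mp hS, controlled, ← tensOp_add_right]
  simp [tensOp_one]

theorem tensOp_mem {S : Matrix (α × α) (α × α) ℂ} (hS : S ∈ unitaryGroup (α × α) ℂ)
    {E : Matrix G G ℂ} (hE : E ∈ unitaryGroup G ℂ) :
    tensOp S E ∈ unitaryGroup (α × (α × G)) ℂ := by
  rw [mem_unitaryGroup_iff] at *
  rw [star_eq_conjTranspose] at *
  rw [tensOp_conjTranspose, tensOp_mul, hS, hE, tensOp_one]

end Tensor

theorem permutation_mem {ι : Type} [Fintype ι] [DecidableEq ι] (τ : ι ≃ ι) :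
    (1 : Matrix ι ι ℂ).submatrix τ id ∈ unitaryGroup ι ℂ := by
  rw [mem_unitaryGroup_iff, star_eq_conjTranspose, conjTranspose_submatrix, conjTranspose_one,
    ← submatrix_mul _ _ _ _ _ Function.bijective_id, one_mul]
  exact submatrix_one_equiv _

theorem permutation_mulVec {ι : Type} [Fintype ι] [DecidableEq ι] (τ : ι → ι) (v : ι → ℂ) :
    (1 : Matrix ι ι ℂ).submatrix τ id *ᵥ v = v ∘ τ := by
  ext i
  simp [mulVec, dotProduct, one_apply]

/-- A unit vector extends to an orthonormal basis, whose members become the columns of the unitary.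
-/
theorem exists_unitary_mulVec_single {ι : Type} [Fintype ι] [DecidableEq ι] (i₀ : ι) (v : ι → ℂ)
    (hv : star v ⬝ᵥ v = 1) : ∃ V ∈ unitaryGroup ι ℂ, V *ᵥ Pi.single i₀ 1 = v := by
  have hn : ‖(WithLp.toLp 2 v : EuclideanSpace ℂ ι)‖ = 1 := by
    have : inner ℂ (WithLp.toLp 2 v : EuclideanSpace ℂ ι) (WithLp.toLp 2 v) = 1 := by
      rw [EuclideanSpace.inner_toLp_toLp, dotProduct_comm]
      exact hv
    rw [inner_self_eq_norm_sq_to_K] at this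
    have h2 : ‖(WithLp.toLp 2 v : EuclideanSpace ℂ ι)‖ ^ 2 = 1 := by
      apply Complex.ofReal_injective
      simpa using this
    nlinarith [norm_nonneg (WithLp.toLp 2 v : EuclideanSpace ℂ ι)]
  obtain ⟨b, hb⟩ := Orthonormal.exists_orthonormalBasis_extension_of_card_eq (𝕜 := ℂ)
    (E := EuclideanSpace ℂ ι) (ι := ι) (by simp)
    (v := fun _ => (WithLp.toLp 2 v : EuclideanSpace ℂ ι)) (s := {i₀}) (by
      constructor
      · intro i; exact hn
      · intro i j hij
        exact absurd (Subsingleton.elim i j) hij)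
  refine ⟨of fun i j => b j i, ?_, ?_⟩
  · rw [mem_unitaryGroup_iff']
    ext i j
    have := orthonormal_iff_ite.mp b.orthonormal i j
    rw [EuclideanSpace.inner_eq_star_dotProduct] at this
    simp only [mul_apply, star_apply, of_apply, one_apply]
    rw [← this, dotProduct]
    exact Finset.sum_congr rfl fun k _ => by simp [mul_comm]
  · ext i
    simp [hb i₀ rfl]

/-! ### The qubitized walk -/

section Walk

variable {n m : ℕ}

/-- Exchange of the two copies of the register `A`. -/
def swapA (n m : ℕ) : Sys n m × Sys n m ≃ Sys n m × Sys n m where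
  toFun x := ((x.2.1, x.1.2), (x.1.1, x.2.2))
  invFun x := ((x.2.1, x.1.2), (x.1.1, x.2.2))
  left_inv _ := rfl
  right_inv _ := rfl

/-- The Hermitian unitary `U† SWAP U`, which block-encodes the reduced state. -/
def blockEncoding (U : Unitaries (Sys n m)) : Matrix (Sys n m × Sys n m) (Sys n m × Sys n m) ℂ :=
  oracleOp (Sys n m) U true *
    ((1 : Matrix (Sys n m × Sys n m) (Sys n m × Sys n m) ℂ).submatrix (swapA n m) id *
      oracleOp (Sys n m) U false)

/-- The reflection `2|0⟩⟨0| - 1` on the first system. -/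
def reflectZero (n m : ℕ) : Matrix (Sys n m × Sys n m) (Sys n m × Sys n m) ℂ :=
  diagonal fun x => if x.1 = 0 then 1 else -1

theorem reflectZero_conjTranspose : (reflectZero n m)ᴴ = reflectZero n m := by
  rw [reflectZero, diagonal_conjTranspose]
  congr 1
  ext x
  by_cases h : x.1 = 0 <;> simp [h]

theorem reflectZero_mul_self : reflectZero n m * reflectZero n m = 1 := by
  rw [reflectZero, diagonal_mul_diagonal, ← diagonal_one]
  congr 1
  ext x
  by_cases h : x.1 = 0 <;> simp [h]

theorem reflectZero_mem : reflectZero n m ∈ unitaryGroup (Sys n m × Sys n m) ℂ := by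
  rw [mem_unitaryGroup_iff, star_eq_conjTranspose, reflectZero_conjTranspose, reflectZero_mul_self]

/-- The qubitized walk operator. -/
def walk (U : Unitaries (Sys n m)) : Matrix (Sys n m × Sys n m) (Sys n m × Sys n m) ℂ :=
  reflectZero n m * blockEncoding U

theorem blockEncoding_conjTranspose (U : Unitaries (Sys n m)) :
    (blockEncoding U)ᴴ = blockEncoding U := by
  have h : ((1 : Matrix (Sys n m × Sys n m) (Sys n m × Sys n m) ℂ).submatrix (swapA n m) id)ᴴ =
      (1 : Matrix (Sys n m × Sys n m) (Sys n m × Sys n m) ℂ).submatrix (swapA n m) id := by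
    ext ⟨⟨a, b⟩, a', b'⟩ ⟨⟨c, d⟩, c', d'⟩
    simp [one_apply, swapA, apply_ite]
    grind
  simp [blockEncoding, h, oracleOp_conjTranspose, Matrix.mul_assoc]

theorem blockEncoding_mem (U : Unitaries (Sys n m)) :
    blockEncoding U ∈ unitaryGroup (Sys n m × Sys n m) ℂ :=
  mul_mem (oracleOp_mem _ U _) (mul_mem (permutation_mem _) (oracleOp_mem _ U _))

theorem walk_mem (U : Unitaries (Sys n m)) : walk U ∈ unitaryGroup (Sys n m × Sys n m) ℂ :=
  mul_mem reflectZero_mem (blockEncoding_mem U)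

variable {G : Type} [DecidableEq G]

theorem oracleOp_prod (U : Unitaries (Sys n m)) (b : Bool) :
    oracleOp (Sys n m × G) U b = tensOp (oracleOp (Sys n m) U b) 1 := by
  ext ⟨x, y, g⟩ ⟨x', y', g'⟩
  simp only [oracleOp, tensOp, kroneckerMap_apply, submatrix_apply, Equiv.prodAssoc_symm_apply,
    one_apply, Prod.mk.injEq]
  by_cases h1 : y = y' <;> by_cases h2 : g = g' <;> simp [h1, h2]

variable [Fintype G]

/-- Only the swap and the reflection need a control: when the control is off, the two uncontrolled
queries cancel as U†U = 1. -/
theorem realizes_controlled_walk {E : Matrix G G ℂ} (hE : E * E = E) (hE' : Eᴴ = E) :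
    Realizes (n := n) (m := m) (Sys n m × G) 2 (fun U => controlled E (walk U)) := by
  have h1 := (((Realizes.one (n := n) (m := m) (Y := Sys n m × G)).query_mul false).gate_mul _
    (controlled_mem hE hE' (permutation_mem (swapA n m)))).query_mul true
  have h2 := h1.gate_mul _ (controlled_mem hE hE' (reflectZero_mem (n := n) (m := m)))
  convert h2 using 2 with U
  have h3 : oracleOp (Sys n m) U true * oracleOp (Sys n m) U false = 1 := by
    have := mem_unitaryGroup_iff'.mp (oracleOp_mem (Sys n m) U false)
    rwa [star_eq_conjTranspose, oracleOp_conjTranspose] at this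
  have h4 : controlled E (blockEncoding U) = tensOp (oracleOp (Sys n m) U true) 1 *
      (controlled E ((1 : Matrix (Sys n m × Sys n m) _ ℂ).submatrix (swapA n m) id) *
        tensOp (oracleOp (Sys n m) U false) 1) := by
    simp only [controlled, add_mul, mul_add, tensOp_mul, Matrix.mul_one, Matrix.one_mul, h3]
    rfl
  rw [walk, ← controlled_mul hE, h4, oracleOp_prod, oracleOp_prod]
  simp

end Walk

end QEntropy

namespace QEntropy

open Matrix

/-! ### Quantum signal processing with vector-valued polynomials -/

section VectorPolynomial

variable {G : Type} [Fintype G]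

/-- The value at `z` of the polynomial with coefficient vectors `v 0, …, v d`. -/
def vecEval (d : ℕ) (v : ℕ → G → ℂ) (z : ℂ) : G → ℂ :=
  ∑ k ∈ Finset.range (d + 1), z ^ k • v k

theorem star_mul_self_of_norm_one {z : ℂ} (hz : ‖z‖ = 1) : star z * z = 1 := by
  rw [Complex.star_def, ← Complex.normSq_eq_conj_mul_self, Complex.normSq_eq_norm_sq, hz]
  simp

theorem vecEval_dotProduct (d : ℕ) (v : ℕ → G → ℂ) (z : ℂ) :
    star (vecEval d v z) ⬝ᵥ vecEval d v z =
      ∑ k ∈ Finset.range (d + 1), ∑ l ∈ Finset.range (d + 1),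
        star (z ^ k) * z ^ l * (star (v k) ⬝ᵥ v l) := by
  simp only [vecEval, star_sum, sum_dotProduct, dotProduct_sum, star_smul, smul_dotProduct,
    dotProduct_smul, smul_eq_mul]
  rw [Finset.sum_comm]
  refine Finset.sum_congr rfl fun k _ => ?_
  rw [Finset.mul_sum]
  refine Finset.sum_congr rfl fun l _ => ?_
  ring

theorem infinite_unit_circle : {z : ℂ | ‖z‖ = 1}.Infinite := by
  have : {z : ℂ | ‖z‖ = 1} = Metric.sphere (0 : ℂ) 1 := by ext; simp
  rw [this]
  exact (isConnected_sphere (E := ℂ) (by simp) 0 (zero_le_one' ℝ)).isPreconnected.infinite_of_nontrivial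
    ⟨1, by simp, -1, by simp, by norm_num⟩

/-- The extreme coefficients of a polynomial with unit-vector values on the circle are orthogonal.
-/
theorem extreme_coeff_orthogonal {d : ℕ} (hd : 1 ≤ d) (v : ℕ → G → ℂ)
    (hv : ∀ z : ℂ, ‖z‖ = 1 → star (vecEval d v z) ⬝ᵥ vecEval d v z = 1) :
    star (v 0) ⬝ᵥ v d = 0 := by
  open Polynomial in
  -- On the circle the conjugate of z is 1/z, so `P` evaluates to z^d (‖v(z)‖² - 1) there. The
  -- truncated subtraction is exact because k ≤ d.
  set P : ℂ[X] := (∑ k ∈ Finset.range (d + 1), ∑ l ∈ Finset.range (d + 1),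
    C (star (v k) ⬝ᵥ v l) * X ^ ((d - k) + l)) - X ^ d with hP
  have hP0 : P = 0 := by
    refine Polynomial.eq_zero_of_infinite_isRoot P (infinite_unit_circle.mono fun z hz => ?_)
    have hz1 : star z * z = 1 := star_mul_self_of_norm_one hz
    have h := hv z hz
    rw [vecEval_dotProduct] at h
    have : P.eval z = z ^ d * ((∑ k ∈ Finset.range (d + 1), ∑ l ∈ Finset.range (d + 1),
        star (z ^ k) * z ^ l * (star (v k) ⬝ᵥ v l)) - 1) := by
      simp only [hP, Polynomial.eval_sub, Polynomial.eval_finsetSum, Polynomial.eval_mul,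
        Polynomial.eval_C, Polynomial.eval_pow, Polynomial.eval_X, mul_sub, Finset.mul_sum, mul_one]
      congr 1
      refine Finset.sum_congr rfl fun k hk => Finset.sum_congr rfl fun l _ => ?_
      have hk' : d = (d - k) + k := by have := Finset.mem_range.mp hk; omega
      have h5 : z ^ d * star (z ^ k) = z ^ (d - k) := by
        conv_lhs => rw [hk', pow_add]
        rw [mul_assoc, star_pow, ← mul_pow, mul_comm z, hz1, one_pow, mul_one]
      rw [← mul_assoc, ← mul_assoc, h5, pow_add]
      ring
    rw [Set.mem_ofPred_eq, Polynomial.IsRoot, this, h, sub_self, mul_zero]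
  -- Only k = 0, l = d reaches degree 2d; since d ≥ 1, the subtracted X^d does not.
  have hc : P.coeff (2 * d) = star (v 0) ⬝ᵥ v d := by
    rw [hP, Polynomial.coeff_sub, Polynomial.finsetSum_coeff, Finset.sum_eq_single 0,
      Polynomial.finsetSum_coeff, Finset.sum_eq_single d]
    · rw [Polynomial.coeff_C_mul, Polynomial.coeff_X_pow, Polynomial.coeff_X_pow]
      rw [if_pos (by omega), if_neg (by omega)]
      simp
    · intro l hl hne
      have := Finset.mem_range.mp hl
      rw [Polynomial.coeff_C_mul, Polynomial.coeff_X_pow, if_neg (by omega), mul_zero]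
    · intro h; simp at h
    · intro k hk hne
      rw [Polynomial.finsetSum_coeff]
      refine Finset.sum_eq_zero fun l hl => ?_
      have := Finset.mem_range.mp hl
      rw [Polynomial.coeff_C_mul, Polynomial.coeff_X_pow, if_neg (by omega), mul_zero]
    · intro h; simp at h
  rw [← hc, hP0, Polynomial.coeff_zero]

/-- The orthogonal projector onto the line of `w`, or zero when `w` vanishes. -/
theorem exists_projector [DecidableEq G] (u w : G → ℂ) (h : star u ⬝ᵥ w = 0) :
    ∃ E : Matrix G G ℂ, E * E = E ∧ Eᴴ = E ∧ E *ᵥ w = w ∧ E *ᵥ u = 0 := by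
  by_cases hw : w = 0
  · exact ⟨0, by simp, by simp, by simp [hw], by simp⟩
  have hc : star w ⬝ᵥ w ≠ 0 := by simpa using hw
  have hr : star (star w ⬝ᵥ w) = star w ⬝ᵥ w := (star_dotProduct w w).symm
  have h' : star w ⬝ᵥ u = 0 := by
    rw [star_dotProduct, h, star_zero]
  refine ⟨(star w ⬝ᵥ w)⁻¹ • vecMulVec w (star w), ?_, ?_, ?_, ?_⟩
  · rw [smul_mul_smul_comm, vecMulVec_mul_vecMulVec, vecMulVec_smul, smul_smul]
    congr 1
    field_simp
  · rw [conjTranspose_smul, conjTranspose_vecMulVec, star_star, star_inv₀, hr]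
  · rw [smul_mulVec, vecMulVec_mulVec, op_smul_eq_smul, smul_smul, inv_mul_cancel₀ hc, one_smul]
  · rw [smul_mulVec, vecMulVec_mulVec, op_smul_eq_smul, h', zero_smul, smul_zero]

/-- For a unimodular c the operator (1 - E) + cE is unitary. -/
theorem dotProduct_projector_shift [DecidableEq G] {E : Matrix G G ℂ} (hE : E * E = E)
    (hE' : Eᴴ = E) {c : ℂ} (hc : star c * c = 1) (x : G → ℂ) :
    star ((1 - E) *ᵥ x + c • E *ᵥ x) ⬝ᵥ ((1 - E) *ᵥ x + c • E *ᵥ x) = star x ⬝ᵥ x := by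
  have hU : ((1 - E) + c • E)ᴴ * ((1 - E) + c • E) = 1 := by
    simp only [conjTranspose_add, conjTranspose_sub, conjTranspose_one, conjTranspose_smul, hE',
      add_mul, mul_add, sub_mul, mul_sub, one_mul, mul_one, smul_mul_assoc, mul_smul_comm, hE,
      smul_add, smul_sub, smul_smul, mul_comm c, hc]
    simp
  rw [← smul_mulVec, ← add_mulVec, star_mulVec, ← dotProduct_mulVec, mulVec_mulVec, hU, one_mulVec]

end VectorPolynomial

variable {n m : ℕ} {G : Type} [Fintype G] [DecidableEq G]

/-- Quantum signal processing with an ancilla of arbitrary dimension: every vector-valued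
polynomial of degree `d` with unit-vector values on the circle can be applied to the walk
operator with `2 d` queries. -/
theorem exists_realizes_polynomial (g₀ : G) (d : ℕ) : ∀ v : ℕ → G → ℂ,
    (∀ z : ℂ, ‖z‖ = 1 → star (vecEval d v z) ⬝ᵥ vecEval d v z = 1) →
    ∃ F, Realizes (n := n) (m := m) (Sys n m × G) (2 * d) F ∧
      ∀ U χ, F U *ᵥ tens χ (Pi.single g₀ 1) =
        ∑ k ∈ Finset.range (d + 1), tens ((walk U ^ k) *ᵥ χ) (v k) := by
  induction d with
  | zero =>
    intro v hv
    have h := hv 1 (by simp)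
    simp only [vecEval, zero_add, Finset.range_one, Finset.sum_singleton, pow_zero, one_smul] at h
    obtain ⟨V, hV, hV'⟩ := exists_unitary_mulVec_single g₀ (v 0) h
    refine ⟨_, Realizes.gate ⟨_, tensOp_mem (one_mem _) hV⟩, fun U χ => ?_⟩
    simp [tensOp_mulVec, hV']
  | succ d ih =>
    intro v hv
    obtain ⟨E, hE, hE', hEd, hE0⟩ :=
      exists_projector (v 0) (v (d + 1)) (extreme_coeff_orthogonal (by omega) v hv)
    -- These are the coefficients of ((1 - E) + z⁻¹E) v(z). The choice of `E` kills the terms of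
    -- degree -1 and d + 1, so the degree drops by one; the controlled walk restores the factor (1 -
    -- E) + zE.
    set v' : ℕ → G → ℂ := fun k => (1 - E) *ᵥ v k + E *ᵥ v (k + 1) with hv'
    have h1d : (1 - E) *ᵥ v (d + 1) = 0 := by rw [sub_mulVec, one_mulVec, hEd, sub_self]
    have hEE : ∀ x, E *ᵥ ((1 - E) *ᵥ x) = 0 := by
      intro x; rw [mulVec_mulVec, mul_sub, hE, mul_one, sub_self, zero_mulVec]
    have hEE' : ∀ x, (1 - E) *ᵥ (E *ᵥ x) = 0 := by
      intro x; rw [mulVec_mulVec, sub_mul, hE, one_mul, sub_self, zero_mulVec]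
    have hEE2 : ∀ x, E *ᵥ (E *ᵥ x) = E *ᵥ x := by
      intro x; rw [mulVec_mulVec, hE]
    have hEE3 : ∀ x, (1 - E) *ᵥ ((1 - E) *ᵥ x) = (1 - E) *ᵥ x := by
      intro x; nth_rewrite 1 [sub_mulVec]; rw [hEE, one_mulVec, sub_zero]
    obtain ⟨F, hF, hF'⟩ := ih v' (by
      intro z hz
      have hz1 := star_mul_self_of_norm_one hz
      rw [← hv z hz, ← dotProduct_projector_shift hE hE' (c := star z)
        (by rw [star_star, mul_comm]; exact hz1) (vecEval (d + 1) v z)]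
      suffices h : vecEval d v' z =
          (1 - E) *ᵥ vecEval (d + 1) v z + star z • E *ᵥ vecEval (d + 1) v z by rw [h]
      simp only [vecEval, hv', smul_add, Finset.sum_add_distrib, mulVec_sum, mulVec_smul]
      congr 1
      · rw [Finset.sum_range_succ _ (d + 1), h1d, smul_zero, add_zero]
      · rw [Finset.sum_range_succ' _ (d + 1), hE0, smul_zero, add_zero, Finset.smul_sum]
        refine Finset.sum_congr rfl fun k _ => ?_
        rw [smul_smul, pow_succ', ← mul_assoc, hz1, one_mul])
    refine ⟨_, by simpa [Nat.mul_succ, add_comm] using (realizes_controlled_walk hE hE').mul hF,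
      fun U χ => ?_⟩
    rw [← mulVec_mulVec, hF', mulVec_sum]
    have hstep : ∀ k, controlled E (walk U) *ᵥ tens ((walk U ^ k) *ᵥ χ) (v' k) =
        tens ((walk U ^ (k + 1)) *ᵥ χ) (E *ᵥ v (k + 1)) +
          tens ((walk U ^ k) *ᵥ χ) ((1 - E) *ᵥ v k) := by
      intro k
      rw [controlled, add_mulVec, tensOp_mulVec, tensOp_mulVec, mulVec_mulVec, ← pow_succ',
        one_mulVec, hv']
      simp only [mulVec_add, hEE, hEE', hEE2, hEE3, zero_add, add_zero]
    simp only [hstep, Finset.sum_add_distrib]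
    have e1 : ∑ k ∈ Finset.range (d + 1), tens ((walk U ^ (k + 1)) *ᵥ χ) (E *ᵥ v (k + 1)) =
        ∑ k ∈ Finset.range (d + 1 + 1), tens ((walk U ^ k) *ᵥ χ) (E *ᵥ v k) := by
      rw [Finset.sum_range_succ' _ (d + 1), hE0, tens_zero_right, add_zero]
    have e2 : ∑ k ∈ Finset.range (d + 1), tens ((walk U ^ k) *ᵥ χ) ((1 - E) *ᵥ v k) =
        ∑ k ∈ Finset.range (d + 1 + 1), tens ((walk U ^ k) *ᵥ χ) ((1 - E) *ᵥ v k) := by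
      rw [Finset.sum_range_succ _ (d + 1), h1d, tens_zero_right, add_zero]
    rw [e1, e2, ← Finset.sum_add_distrib]
    refine Finset.sum_congr rfl fun k _ => ?_
    rw [← tens_add_right, ← add_mulVec]
    simp

end QEntropy

namespace QEntropy

open Matrix

/-! ### Moments of the walk in the purified state -/

section Purification

variable {n m : ℕ}

/-- The vector `|0⟩ ⊗ (X ⊗ 1)|Ψ⟩`, where `|Ψ⟩ = U|0⟩`. -/
def purification (U : Unitaries (Sys n m)) (X : Matrix (Qubits n) (Qubits n) ℂ) :
    Sys n m × Sys n m → ℂ :=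
  fun x => if x.1 = 0 then ∑ a, X x.2.1 a * U.1 (a, x.2.2) 0 else 0

/-- The state of `A` prepared by the oracle. -/
def oracleState (U : Unitaries (Sys n m)) : Matrix (Qubits n) (Qubits n) ℂ :=
  reducedState (U.1.mulVec (zeroState (Sys n m)))

theorem oracleState_apply (U : Unitaries (Sys n m)) (i j : Qubits n) :
    oracleState U i j = ∑ b, U.1 (i, b) 0 * star (U.1 (j, b) 0) := by
  simp [oracleState, reducedState, zeroState]

theorem kronecker_one_mulVec {α β : Type} [Fintype α] [Fintype β] [DecidableEq β]
    (M : Matrix α α ℂ) (φ : α × β → ℂ) (s : α) (t : β) :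
    ((M ⊗ₖ (1 : Matrix β β ℂ)) *ᵥ φ) (s, t) = ∑ s', M s s' * φ (s', t) := by
  simp only [mulVec, dotProduct, kroneckerMap_apply, Fintype.sum_prod_type, one_apply]
  refine Finset.sum_congr rfl fun s' _ => ?_
  rw [Finset.sum_eq_single t] <;> simp +contextual [eq_comm]

theorem reflectZero_mulVec_purification (U : Unitaries (Sys n m))
    (X : Matrix (Qubits n) (Qubits n) ℂ) :
    reflectZero n m *ᵥ purification U X = purification U X := by
  ext x
  rw [reflectZero, mulVec_diagonal]
  by_cases h : x.1 = 0 <;> simp [h, purification]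

/-- The query turns the first system into |Ψ⟩. After the swap of the two `A` registers, the
component along |0⟩ of U† contracts |Ψ⟩ with itself over `B`, which produces ρ on the left of `X`.
-/
theorem blockEncoding_mulVec_purification (U : Unitaries (Sys n m))
    (X : Matrix (Qubits n) (Qubits n) ℂ) (t : Sys n m) :
    (blockEncoding U *ᵥ purification U X) (0, t) = purification U (oracleState U * X) (0, t) := by
  have h1 : ∀ s t, (oracleOp (Sys n m) U false *ᵥ purification U X) (s, t) =
      U.1 s 0 * ∑ a, X t.1 a * U.1 (a, t.2) 0 := by
    intro s t
    simp only [oracleOp, Bool.false_eq_true, if_false, kronecker_one_mulVec, purification]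
    rw [Finset.sum_eq_single 0] <;> simp +contextual
  rw [blockEncoding, ← mulVec_mulVec, ← mulVec_mulVec, permutation_mulVec]
  have h2 : oracleOp (Sys n m) U true = U.1ᴴ ⊗ₖ 1 := by simp [oracleOp]
  rw [h2, kronecker_one_mulVec]
  obtain ⟨a', b'⟩ := t
  have h3 : ∀ s : Sys n m, ((oracleOp (Sys n m) U false *ᵥ purification U X) ∘ swapA n m)
      (s, (a', b')) = U.1 (a', s.2) 0 * ∑ a, X s.1 a * U.1 (a, b') 0 := by
    intro s
    exact h1 (a', s.2) (s.1, b')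
  simp only [h3, purification, if_true, mul_apply, oracleState_apply, conjTranspose_apply]
  rw [Fintype.sum_prod_type]
  simp only [Finset.mul_sum, Finset.sum_mul]
  rw [Finset.sum_congr rfl fun x _ => Finset.sum_comm, Finset.sum_comm]
  refine Finset.sum_congr rfl fun a _ => Finset.sum_congr rfl fun c _ =>
    Finset.sum_congr rfl fun b _ => ?_
  ring

/-- With H the block encoding and R the reflection, W + W† = RH + HR. On vectors fixed by R this is
(R + 1)H, twice the projection of H to |0⟩. -/
theorem walk_add_conjTranspose_mulVec (U : Unitaries (Sys n m))
    (X : Matrix (Qubits n) (Qubits n) ℂ) :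
    walk U *ᵥ purification U X + (walk U)ᴴ *ᵥ purification U X =
      (2 : ℂ) • purification U (oracleState U * X) := by
  rw [walk, conjTranspose_mul, blockEncoding_conjTranspose, reflectZero_conjTranspose,
    ← mulVec_mulVec, ← mulVec_mulVec, reflectZero_mulVec_purification]
  ext ⟨s, t⟩
  rw [Pi.add_apply, reflectZero, mulVec_diagonal]
  by_cases h : s = 0
  · subst h
    simp only [if_true, blockEncoding_mulVec_purification, Pi.smul_apply, smul_eq_mul]
    ring
  · simp [h, purification]

theorem walk_mul_conjTranspose (U : Unitaries (Sys n m)) : walk U * (walk U)ᴴ = 1 :=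
  mem_unitaryGroup_iff.mp (walk_mem U)

/-- The matrix elements of the powers of the walk. -/
def walkMoment (U : Unitaries (Sys n m)) (j : ℕ) (X : Matrix (Qubits n) (Qubits n) ℂ) : ℂ :=
  star (purification U 1) ⬝ᵥ (walk U ^ j *ᵥ purification U X)

theorem walkMoment_zero (U : Unitaries (Sys n m)) (X : Matrix (Qubits n) (Qubits n) ℂ) :
    walkMoment U 0 X = trace (X * oracleState U) := by
  simp only [walkMoment, pow_zero, one_mulVec, dotProduct, Fintype.sum_prod_type, trace, diag,
    mul_apply, oracleState_apply, Pi.star_apply]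
  rw [← Fintype.sum_prod_type (f := fun y : Sys n m => ∑ c : Qubits n, ∑ e : Qubits m,
    star (purification U 1 (y, (c, e))) * purification U X (y, (c, e)))]
  rw [Finset.sum_eq_single 0 (by intro b _ hb; simp [purification, hb]) (by simp)]
  simp only [purification, if_true, one_apply, ite_mul, one_mul, zero_mul, Finset.sum_ite_eq,
    Finset.mem_univ, Finset.mul_sum]
  refine Finset.sum_congr rfl fun a _ => ?_
  rw [Finset.sum_comm]
  refine Finset.sum_congr rfl fun c _ => Finset.sum_congr rfl fun b _ => ?_
  ring

/-- The reflection fixes the vectors on both sides, so W and W† have the same matrix element, half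
of that of their sum. -/
theorem walkMoment_one (U : Unitaries (Sys n m)) (X : Matrix (Qubits n) (Qubits n) ℂ) :
    walkMoment U 1 X = trace (oracleState U * X * oracleState U) := by
  have h := congrArg (fun v => star (purification U 1) ⬝ᵥ v) (walk_add_conjTranspose_mulVec U X)
  simp only [dotProduct_add, dotProduct_smul, smul_eq_mul] at h
  have h0 : star (purification U 1) ⬝ᵥ purification U (oracleState U * X) =
      trace (oracleState U * X * oracleState U) := by
    rw [← walkMoment_zero]; simp [walkMoment]
  have h1 : star (purification U 1) ⬝ᵥ (walk U *ᵥ purification U X) =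
      star (purification U 1) ⬝ᵥ (blockEncoding U *ᵥ purification U X) := by
    rw [walk, ← mulVec_mulVec, dotProduct_mulVec]
    congr 1
    conv_rhs => rw [← reflectZero_mulVec_purification, star_mulVec, reflectZero_conjTranspose]
  have h2 : (walk U)ᴴ *ᵥ purification U X = blockEncoding U *ᵥ purification U X := by
    rw [walk, conjTranspose_mul, blockEncoding_conjTranspose, reflectZero_conjTranspose,
      ← mulVec_mulVec, reflectZero_mulVec_purification]
  rw [h2, h1, h0] at h
  rw [walkMoment, pow_one, h1]
  linear_combination h / 2

/-- The Chebyshev recursion, from W^{j+2} + W^j = W^{j+1}(W + W†). -/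
theorem walkMoment_add_two (U : Unitaries (Sys n m)) (j : ℕ)
    (X : Matrix (Qubits n) (Qubits n) ℂ) :
    walkMoment U (j + 2) X + walkMoment U j X = 2 * walkMoment U (j + 1) (oracleState U * X) := by
  have h := congrArg (fun v => star (purification U 1) ⬝ᵥ (walk U ^ (j + 1) *ᵥ v))
    (walk_add_conjTranspose_mulVec U X)
  simp only [mulVec_add, dotProduct_add, mulVec_smul, dotProduct_smul, smul_eq_mul, mulVec_mulVec,
    ← pow_succ] at h
  rw [pow_succ _ j, Matrix.mul_assoc, walk_mul_conjTranspose, Matrix.mul_one] at h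
  exact h

end Purification

/-! ### Traces in the eigenbasis -/

section Diagonalization

variable {ι : Type} [Fintype ι] [DecidableEq ι] {ρ : Matrix ι ι ℂ}

/-- The operator with the eigenvectors of `ρ` and the eigenvalues `f`. -/
noncomputable def withEigenvalues (h : ρ.IsHermitian) (f : ι → ℂ) : Matrix ι ι ℂ :=
  Unitary.conjStarAlgAut ℂ (Matrix ι ι ℂ) h.eigenvectorUnitary (diagonal f)

theorem mul_withEigenvalues (h : ρ.IsHermitian) (f : ι → ℂ) :
    ρ * withEigenvalues h f = withEigenvalues h (fun i => (h.eigenvalues i : ℂ) * f i) := by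
  refine (congrArg (· * withEigenvalues h f) h.spectral_theorem).trans ?_
  rw [withEigenvalues, withEigenvalues, ← map_mul, diagonal_mul_diagonal]
  rfl

theorem trace_withEigenvalues (h : ρ.IsHermitian) (f : ι → ℂ) :
    trace (withEigenvalues h f) = ∑ i, f i := by
  rw [withEigenvalues, Unitary.conjStarAlgAut_apply, trace_mul_cycle, Unitary.coe_star_mul_self,
    one_mul, trace_diagonal]

theorem withEigenvalues_one (h : ρ.IsHermitian) : withEigenvalues h (fun _ => 1) = 1 := by
  rw [withEigenvalues, diagonal_one, map_one]

theorem trace_mul_cfc (h : ρ.IsHermitian) (f : ℝ → ℝ) :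
    trace (ρ * cfc f ρ) = ∑ i, ((h.eigenvalues i * f (h.eigenvalues i) : ℝ) : ℂ) := by
  have : cfc f ρ = withEigenvalues h (fun i => (f (h.eigenvalues i) : ℂ)) := by
    rw [h.cfc_eq]; rfl
  rw [this, mul_withEigenvalues, trace_withEigenvalues]
  simp

theorem trace_eq_sum (h : ρ.IsHermitian) : trace ρ = ∑ i, (h.eigenvalues i : ℂ) := by
  have := mul_withEigenvalues h (fun _ => 1)
  rw [withEigenvalues_one, mul_one] at this
  conv_lhs => rw [this]
  rw [trace_withEigenvalues]
  simp

theorem vonNeumannEntropy_eq_sum (h : ρ.IsHermitian) :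
    vonNeumannEntropy ρ = -∑ i, h.eigenvalues i * Real.log (h.eigenvalues i) := by
  rw [vonNeumannEntropy, trace_mul_cfc h, ← Complex.ofReal_sum, Complex.ofReal_re]

end Diagonalization

/-! ### The walk as a random phase -/

section Moments

variable {n m : ℕ} {U : Unitaries (Sys n m)}

/-- The recursion is of second order and replaces `X` by ρX. The induction therefore carries two
consecutive moments and an arbitrary function `f` of the eigenbasis. -/
theorem walkMoment_withEigenvalues (h : (oracleState U).IsHermitian)
    (h0 : ∀ i, 0 ≤ h.eigenvalues i) (h1 : ∀ i, h.eigenvalues i ≤ 1) (j : ℕ) :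
    ∀ f : Qubits n → ℂ, walkMoment U j (withEigenvalues h f) =
      ∑ i, f i * ((h.eigenvalues i * Real.cos (j * Real.arccos (h.eigenvalues i)) : ℝ) : ℂ) ∧
      walkMoment U (j + 1) (withEigenvalues h f) =
      ∑ i, f i *
        ((h.eigenvalues i * Real.cos ((j + 1) * Real.arccos (h.eigenvalues i)) : ℝ) : ℂ) := by
  have hcos : ∀ i, Real.cos (Real.arccos (h.eigenvalues i)) = h.eigenvalues i := fun i =>
    Real.cos_arccos (by linarith [h0 i]) (h1 i)
  induction j with
  | zero =>
    intro f
    constructor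
    · rw [walkMoment_zero, trace_mul_comm, mul_withEigenvalues, trace_withEigenvalues]
      refine Finset.sum_congr rfl fun i _ => ?_
      simp [mul_comm]
    · rw [zero_add, walkMoment_one, trace_mul_comm, mul_withEigenvalues, mul_withEigenvalues,
        trace_withEigenvalues]
      refine Finset.sum_congr rfl fun i _ => ?_
      simp only [Nat.cast_zero, zero_add, one_mul, hcos]
      push_cast
      ring
  | succ j ih =>
    intro f
    refine ⟨by simpa using (ih f).2, ?_⟩
    have h2 := walkMoment_add_two U j (withEigenvalues h f)
    rw [mul_withEigenvalues, (ih _).1, (ih _).2] at h2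
    rw [show j + 1 + 1 = j + 2 from rfl, eq_sub_of_add_eq h2, Finset.mul_sum,
      ← Finset.sum_sub_distrib]
    refine Finset.sum_congr rfl fun i _ => ?_
    have h3 : Real.cos (((j + 1 : ℕ) + 1) * Real.arccos (h.eigenvalues i)) =
        2 * h.eigenvalues i * Real.cos ((j + 1) * Real.arccos (h.eigenvalues i)) -
          Real.cos (j * Real.arccos (h.eigenvalues i)) := by
      have e1 : (((j + 1 : ℕ) : ℝ) + 1) * Real.arccos (h.eigenvalues i) =
        (j + 1) * Real.arccos (h.eigenvalues i) + Real.arccos (h.eigenvalues i) := by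
        push_cast; ring
      have e2 : (j : ℝ) * Real.arccos (h.eigenvalues i) =
        (j + 1) * Real.arccos (h.eigenvalues i) - Real.arccos (h.eigenvalues i) := by ring
      rw [e1, e2, Real.cos_add, Real.cos_sub, hcos]
      ring
    rw [h3]
    push_cast
    ring

theorem gram_of_le (h : (oracleState U).IsHermitian)
    (h0 : ∀ i, 0 ≤ h.eigenvalues i) (h1 : ∀ i, h.eigenvalues i ≤ 1) {k l : ℕ} (hkl : k ≤ l) :
    star (walk U ^ k *ᵥ purification U 1) ⬝ᵥ (walk U ^ l *ᵥ purification U 1) =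
      ∑ i, ((h.eigenvalues i *
        Real.cos (((l : ℝ) - k) * Real.arccos (h.eigenvalues i)) : ℝ) : ℂ) := by
  have hu : (walk U ^ k)ᴴ * walk U ^ k = 1 :=
    mem_unitaryGroup_iff'.mp (pow_mem (walk_mem U) k)
  have h2 := (walkMoment_withEigenvalues h h0 h1 (l - k) (fun _ => 1)).1
  rw [withEigenvalues_one, walkMoment] at h2
  simp only [one_mul, Nat.cast_sub hkl] at h2
  rw [← h2, star_mulVec, ← dotProduct_mulVec, mulVec_mulVec,
    show walk U ^ l = walk U ^ k * walk U ^ (l - k) by rw [← pow_add, Nat.add_sub_cancel' hkl],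
    ← Matrix.mul_assoc, hu, Matrix.one_mul]

theorem gram (h : (oracleState U).IsHermitian)
    (h0 : ∀ i, 0 ≤ h.eigenvalues i) (h1 : ∀ i, h.eigenvalues i ≤ 1) (k l : ℕ) :
    star (walk U ^ k *ᵥ purification U 1) ⬝ᵥ (walk U ^ l *ᵥ purification U 1) =
      ∑ i, ((h.eigenvalues i *
        Real.cos (((l : ℝ) - k) * Real.arccos (h.eigenvalues i)) : ℝ) : ℂ) := by
  rcases le_total k l with hkl | hkl
  · exact gram_of_le h h0 h1 hkl
  · rw [star_dotProduct, gram_of_le h h0 h1 hkl, star_sum]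
    refine Finset.sum_congr rfl fun i _ => ?_
    rw [Complex.star_def, Complex.conj_ofReal, ← Real.cos_neg]
    congr 3
    ring

/-- The point of the unit circle in the upper half plane with real part `p`. -/
noncomputable def circlePoint (p : ℝ) : ℂ := Complex.exp (Real.arccos p * Complex.I)

theorem norm_circlePoint (p : ℝ) : ‖circlePoint p‖ = 1 := Complex.norm_exp_ofReal_mul_I _

theorem re_circlePoint {p : ℝ} (h0 : -1 ≤ p) (h1 : p ≤ 1) : (circlePoint p).re = p := by
  rw [circlePoint, Complex.exp_ofReal_mul_I_re, Real.cos_arccos h0 h1]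

theorem ofReal_cos_sub_mul_arccos (p : ℝ) (k l : ℕ) :
    ((Real.cos (((l : ℝ) - k) * Real.arccos p) : ℝ) : ℂ) =
      (star (circlePoint p ^ k) * circlePoint p ^ l +
        star (star (circlePoint p) ^ k) * star (circlePoint p) ^ l) / 2 := by
  have hs : star (circlePoint p) = Complex.exp (-(Real.arccos p * Complex.I)) := by
    rw [circlePoint, Complex.star_def, ← Complex.exp_conj, map_mul, Complex.conj_ofReal,
      Complex.conj_I, mul_neg]
  rw [star_pow, star_pow, star_star, hs, circlePoint, Complex.ofReal_cos, Complex.cos]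
  simp only [← Complex.exp_nat_mul, ← Complex.exp_add]
  congr 3
  · push_cast; ring
  · push_cast; ring

theorem sum_norm_sq_eq_dotProduct {ι : Type} [Fintype ι] (v : ι → ℂ) :
    ((∑ x, ‖v x‖ ^ 2 : ℝ) : ℂ) = star v ⬝ᵥ v := by
  rw [dotProduct, Complex.ofReal_sum]
  refine Finset.sum_congr rfl fun x _ => ?_
  rw [Pi.star_apply, Complex.star_def, ← Complex.normSq_eq_conj_mul_self,
    Complex.normSq_eq_norm_sq]

/-- The Gram matrix of the vectors W^k|Ψ⟩ depends on l - k only, through cosines, and each cosine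
averages the contributions of z and its conjugate. Hence a polynomial in W has the squared norm it
would have at a random phase. -/
theorem norm_sq_sum_smul_walk (h : (oracleState U).IsHermitian)
    (h0 : ∀ i, 0 ≤ h.eigenvalues i) (h1 : ∀ i, h.eigenvalues i ≤ 1) (d : ℕ) (a : ℕ → ℂ) :
    ∑ x, ‖(∑ k ∈ Finset.range d, a k • (walk U ^ k *ᵥ purification U 1)) x‖ ^ 2 =
      ∑ i, h.eigenvalues i *
        ((‖∑ k ∈ Finset.range d, a k * circlePoint (h.eigenvalues i) ^ k‖ ^ 2 +
          ‖∑ k ∈ Finset.range d, a k * star (circlePoint (h.eigenvalues i)) ^ k‖ ^ 2) / 2) := by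
  have hnorm : ∀ z : ℂ, ((‖∑ k ∈ Finset.range d, a k * z ^ k‖ ^ 2 : ℝ) : ℂ) =
      ∑ k ∈ Finset.range d, ∑ l ∈ Finset.range d, star (a k) * a l * (star (z ^ k) * z ^ l) := by
    intro z
    rw [← Complex.normSq_eq_norm_sq, Complex.normSq_eq_conj_mul_self, map_sum, Finset.sum_mul_sum]
    refine Finset.sum_congr rfl fun k _ => Finset.sum_congr rfl fun l _ => ?_
    rw [map_mul, Complex.star_def]
    ring
  apply Complex.ofReal_injective
  rw [sum_norm_sq_eq_dotProduct, star_sum, sum_dotProduct]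
  simp only [dotProduct_sum, star_smul, smul_dotProduct, dotProduct_smul, smul_eq_mul,
    gram h h0 h1, Complex.ofReal_sum, Complex.ofReal_mul, Complex.ofReal_div, Complex.ofReal_add,
    hnorm, ofReal_cos_sub_mul_arccos, Finset.mul_sum, ← Finset.sum_add_distrib, Finset.sum_div]
  rw [Finset.sum_congr rfl fun k _ => Finset.sum_comm, Finset.sum_comm]
  refine Finset.sum_congr rfl fun i _ => Finset.sum_congr rfl fun k _ =>
    Finset.sum_congr rfl fun l _ => ?_
  push_cast
  ring

end Moments

end QEntropy

namespace QEntropy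

open Matrix

/-! ### From sum-of-squares certificates to coins -/

section SumsOfSquares

open Polynomial

/-- On the unit circle `g` is a sum of squared moduli of polynomials of degree at most `d`. -/
def IsSOS (d : ℕ) (g : ℂ → ℝ) : Prop :=
  ∃ (ι : Type) (_ : Fintype ι) (Q : ι → ℂ[X]), (∀ i, (Q i).natDegree ≤ d) ∧
    ∀ z : ℂ, ‖z‖ = 1 → g z = ∑ i, ‖(Q i).eval z‖ ^ 2

/-- Padding by zero polynomials; every large `k` is allowed so that the certificates of g and 1 - g
can share one register. -/
theorem IsSOS.exists_qubits {d : ℕ} {g : ℂ → ℝ} (hg : IsSOS d g) :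
    ∃ k₀ : ℕ, ∀ k, k₀ ≤ k → ∃ Q : Qubits k → ℂ[X], (∀ i, (Q i).natDegree ≤ d) ∧
      ∀ z : ℂ, ‖z‖ = 1 → g z = ∑ i, ‖(Q i).eval z‖ ^ 2 := by
  obtain ⟨ι, _, Q, hQ, h⟩ := hg
  refine ⟨Fintype.card ι, fun k hk => ?_⟩
  have hcard : Fintype.card ι ≤ Fintype.card (Qubits k) := by
    simp only [Fintype.card_pi, Fintype.card_fin, Finset.prod_const, Finset.card_univ]
    exact hk.trans Nat.lt_two_pow_self.le
  obtain ⟨f⟩ := Function.Embedding.nonempty_of_card_le hcard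
  refine ⟨Function.extend f Q 0, fun i => ?_, fun z hz => ?_⟩
  · by_cases hi : ∃ j, f j = i
    · obtain ⟨j, rfl⟩ := hi
      rw [f.injective.extend_apply]
      exact hQ j
    · rw [Function.extend_apply' _ _ _ hi]
      simp
  · rw [h z hz]
    refine Fintype.sum_of_injective f f.injective _ _ (fun i hi => ?_) fun i => ?_
    · rw [Function.extend_apply' _ _ _ hi]
      simp
    · rw [f.injective.extend_apply]

end SumsOfSquares

variable {n m : ℕ}

/-- The probability of outcome `1` for a coin with bias `g` evaluated at the walk's eigenphases. -/
noncomputable def coinProb {ι : Type} [Fintype ι] [DecidableEq ι] {ρ : Matrix ι ι ℂ}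
    (h : ρ.IsHermitian) (g : ℂ → ℝ) : ℝ :=
  ∑ i, h.eigenvalues i * ((g (circlePoint (h.eigenvalues i)) +
    g (star (circlePoint (h.eigenvalues i)))) / 2)

/-- The walk expects |0⟩ in the first system and |Ψ⟩ in the second, while a query acts on the first;
hence the exchange after the query. -/
theorem swap_oracle_mulVec_single {G : Type} [Fintype G] [DecidableEq G] (g₀ : G)
    (U : Unitaries (Sys n m)) :
    ((1 : Matrix (Sys n m × (Sys n m × G)) (Sys n m × (Sys n m × G)) ℂ).submatrix
        (fun x => (x.2.1, (x.1, x.2.2))) id *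
      oracleOp (Sys n m × G) U false) *ᵥ Pi.single (0, (0, g₀)) 1 =
    tens (purification U 1) (Pi.single g₀ 1) := by
  rw [← mulVec_mulVec, permutation_mulVec]
  ext ⟨s, t, g⟩
  simp only [Function.comp_apply, mulVec_single_one, col_apply, oracleOp, kroneckerMap_apply, tens,
    purification, one_apply, Prod.mk.injEq, Pi.single_apply]
  by_cases hs : s = 0 <;> by_cases hg : g = g₀ <;> simp [hs, hg]

/-- The squares for g are labelled by the bit 1 and those for 1 - g by 0, so together they have norm
one on the circle. The extra query prepares |Ψ⟩. -/
theorem exists_realizes_coin {d : ℕ} {g : ℂ → ℝ} (hg : IsSOS d g) (hg' : IsSOS d (fun z => 1 - g z)) :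
    ∃ (k : ℕ) (F : Unitaries (Sys n m) → Matrix _ _ ℂ),
      Realizes (Sys n m × (Fin 2 × Qubits k)) (2 * d + 1) F ∧
      ∀ (U : Unitaries (Sys n m)) (h : (oracleState U).IsHermitian),
        (∀ i, 0 ≤ h.eigenvalues i) → (∀ i, h.eigenvalues i ≤ 1) →
        ∑ x, (if x.2.2.1 = 1 then ‖(F U *ᵥ Pi.single (0, 0) 1) x‖ ^ 2 else 0) = coinProb h g := by
  obtain ⟨k₁, h₁⟩ := hg.exists_qubits
  obtain ⟨k₂, h₂⟩ := hg'.exists_qubits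
  obtain ⟨k, hk₁, hk₂⟩ : ∃ k, k₁ ≤ k ∧ k₂ ≤ k := ⟨_, le_max_left _ _, le_max_right _ _⟩
  obtain ⟨Q, hQd, hQ⟩ := h₁ k hk₁
  obtain ⟨R, hRd, hR⟩ := h₂ k hk₂
  set v : ℕ → Fin 2 × Qubits k → ℂ :=
    fun j x => if x.1 = 1 then (Q x.2).coeff j else (R x.2).coeff j with hv
  have hvQ : ∀ z x, ∑ j ∈ Finset.range (d + 1), v j (1, x) * z ^ j = (Q x).eval z := by
    intro z x
    rw [Polynomial.eval_eq_sum_range' (Nat.lt_succ_of_le (hQd x))]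
    simp [hv]
  have hvR : ∀ z x, ∑ j ∈ Finset.range (d + 1), v j (0, x) * z ^ j = (R x).eval z := by
    intro z x
    rw [Polynomial.eval_eq_sum_range' (Nat.lt_succ_of_le (hRd x))]
    simp [hv]
  have hval : ∀ z x, vecEval d v z x = ∑ j ∈ Finset.range (d + 1), v j x * z ^ j := by
    intro z x
    simp only [vecEval, Finset.sum_apply, Pi.smul_apply, smul_eq_mul]
    exact Finset.sum_congr rfl fun j _ => mul_comm _ _
  obtain ⟨F, hF, hF'⟩ := exists_realizes_polynomial (n := n) (m := m) (0 : Fin 2 × Qubits k) d v (by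
    intro z hz
    rw [← sum_norm_sq_eq_dotProduct, Fintype.sum_prod_type, Fin.sum_univ_two]
    simp only [hval, hvQ, hvR, ← hQ z hz, ← hR z hz]
    simp)
  refine ⟨k, _, hF.mul ((Realizes.one.query_mul false).gate_mul _
    (permutation_mem (⟨fun x => (x.2.1, (x.1, x.2.2)), fun x => (x.2.1, (x.1, x.2.2)),
      fun _ => rfl, fun _ => rfl⟩ : Sys n m × (Sys n m × (Fin 2 × Qubits k)) ≃ _))), ?_⟩
  intro U h h0 h1
  have hfin : (F U * ((1 : Matrix (Sys n m × (Sys n m × (Fin 2 × Qubits k))) _ ℂ).submatrix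
        (fun x => (x.2.1, (x.1, x.2.2))) id * (oracleOp _ U false * 1))) *ᵥ Pi.single (0, 0) 1 =
      ∑ j ∈ Finset.range (d + 1), tens ((walk U ^ j) *ᵥ purification U 1) (v j) := by
    rw [mul_one, ← mulVec_mulVec]
    refine (congrArg (F U *ᵥ ·) (swap_oracle_mulVec_single (0 : Fin 2 × Qubits k) U)).trans ?_
    exact hF' U _
  simp only [Equiv.coe_fn_mk, hfin]
  have hentry : ∀ (s t : Sys n m) (y : Fin 2 × Qubits k),
      (∑ j ∈ Finset.range (d + 1), tens ((walk U ^ j) *ᵥ purification U 1) (v j)) (s, (t, y)) =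
      (∑ j ∈ Finset.range (d + 1), v j y • ((walk U ^ j) *ᵥ purification U 1)) (s, t) := by
    intro s t y
    simp only [Finset.sum_apply, tens, Pi.smul_apply, smul_eq_mul]
    exact Finset.sum_congr rfl fun j _ => mul_comm _ _
  have hcoin : coinProb h g = ∑ y : Qubits k, ∑ x : Sys n m × Sys n m,
      ‖(∑ j ∈ Finset.range (d + 1), v j (1, y) • ((walk U ^ j) *ᵥ purification U 1)) x‖ ^ 2 := by
    have hstar : ∀ p, ‖star (circlePoint p)‖ = 1 := fun p => by rw [norm_star, norm_circlePoint]
    simp only [norm_sq_sum_smul_walk h h0 h1, hvQ]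
    rw [Finset.sum_comm]
    refine Finset.sum_congr rfl fun i _ => ?_
    rw [← Finset.mul_sum, ← Finset.sum_div, Finset.sum_add_distrib, ← hQ _ (norm_circlePoint _),
      ← hQ _ (hstar _)]
  rw [hcoin]
  refine Eq.trans ?_ Finset.sum_comm
  refine ((Fintype.sum_prod_type _).trans ?_).trans (Fintype.sum_prod_type _).symm
  refine Finset.sum_congr rfl fun s _ => ?_
  rw [Fintype.sum_prod_type]
  refine Finset.sum_congr rfl fun t _ => ?_
  rw [Fintype.sum_prod_type, Fin.sum_univ_two]
  simp only [hentry]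
  simp

/-! ### Amplitude amplification -/

section Amplification

variable {Y : Type} [Fintype Y] [DecidableEq Y]

theorem rankOne_reflection_mem {ι : Type} [Fintype ι] [DecidableEq ι] (i₀ : ι) :
    (diagonal fun i => if i = i₀ then (1 : ℂ) else -1) ∈ unitaryGroup ι ℂ := by
  rw [mem_unitaryGroup_iff, star_eq_conjTranspose, diagonal_conjTranspose, diagonal_mul_diagonal,
    ← diagonal_one]
  congr 1
  ext i
  by_cases h : i = i₀ <;> simp [h]

theorem signDiagonal_mem {ι : Type} [Fintype ι] [DecidableEq ι] (S : ι → Prop) [DecidablePred S] :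
    (diagonal fun i => if S i then (1 : ℂ) else -1) ∈ unitaryGroup ι ℂ := by
  rw [mem_unitaryGroup_iff, star_eq_conjTranspose, diagonal_conjTranspose, diagonal_mul_diagonal,
    ← diagonal_one]
  congr 1
  ext i
  by_cases h : S i <;> simp [h]

/-- The Grover iterate of a unitary `A` with initial basis state `i₀` and good set `S`. -/
def groverOp {ι : Type} [Fintype ι] [DecidableEq ι] (A : Matrix ι ι ℂ) (i₀ : ι) (S : ι → Prop)
    [DecidablePred S] : Matrix ι ι ℂ :=
  A * ((diagonal fun i => if i = i₀ then (1 : ℂ) else -1) *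
    (Aᴴ * diagonal fun i => if S i then (-1 : ℂ) else 1))

/-- The iterate preserves the plane spanned by the good and bad parts of ψ, being a sign flip
followed by the reflection about ψ; `a` and `b` are coordinates in this plane. -/
theorem groverOp_mulVec {ι : Type} [Fintype ι] [DecidableEq ι] {A : Matrix ι ι ℂ}
    (hA : A ∈ unitaryGroup ι ℂ) (i₀ : ι) (S : ι → Prop) [DecidablePred S] (a b : ℝ) :
    let ψ := A *ᵥ Pi.single i₀ 1
    let p : ℝ := ∑ i, if S i then ‖ψ i‖ ^ 2 else 0
    groverOp A i₀ S *ᵥ (fun i => (if S i then (a : ℂ) else b) * ψ i) =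
      fun i => (if S i then (((1 - 2 * p) * a + 2 * (1 - p) * b : ℝ) : ℂ)
        else (((1 - 2 * p) * b - 2 * p * a : ℝ) : ℂ)) * ψ i := by
  intro ψ p
  have hAA : A * Aᴴ = 1 := mem_unitaryGroup_iff.mp hA
  have hAA' : Aᴴ * A = 1 := mem_unitaryGroup_iff'.mp hA
  have hdiag : (diagonal fun i => if i = i₀ then (1 : ℂ) else -1) =
      (2 : ℂ) • vecMulVec (Pi.single i₀ 1) (star (Pi.single i₀ 1)) - 1 := by
    ext i j
    simp only [diagonal_apply, Matrix.sub_apply, Matrix.smul_apply, vecMulVec_apply, Pi.star_apply,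
      Pi.single_apply, one_apply, smul_eq_mul]
    by_cases h1 : i = j
    · subst h1
      by_cases h2 : i = i₀
      · simp [h2]
        norm_num
      · simp [h2]
    · by_cases h2 : i = i₀
      · have : ¬ j = i₀ := fun h => h1 (h2.trans h.symm)
        simp [h1, this]
      · simp [h1, h2]
  have hrefl : ∀ x : ι → ℂ, A *ᵥ ((diagonal fun i => if i = i₀ then (1 : ℂ) else -1) *ᵥ (Aᴴ *ᵥ x)) =
      (2 * (star ψ ⬝ᵥ x)) • ψ - x := by
    intro x
    rw [hdiag, sub_mulVec, smul_mulVec, vecMulVec_mulVec, op_smul_eq_smul, one_mulVec, mulVec_sub,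
      mulVec_smul, mulVec_smul, mulVec_mulVec, hAA, one_mulVec, smul_smul]
    congr 3
    simp only [ψ]
    rw [star_mulVec, ← dotProduct_mulVec]
  have hone : star ψ ⬝ᵥ ψ = 1 := by
    simp only [ψ]
    rw [star_mulVec, ← dotProduct_mulVec, mulVec_mulVec, hAA', one_mulVec]
    simp
  have hp : (∑ i, if S i then star (ψ i) * ψ i else 0) = (p : ℂ) := by
    simp only [p, Complex.ofReal_sum]
    refine Finset.sum_congr rfl fun i _ => ?_
    split_ifs
    · rw [Complex.star_def, ← Complex.normSq_eq_conj_mul_self, Complex.normSq_eq_norm_sq]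
    · simp
  have hp' : (∑ i, if S i then 0 else star (ψ i) * ψ i) = ((1 - p : ℝ) : ℂ) := by
    rw [Complex.ofReal_sub, Complex.ofReal_one, ← hone, ← hp, dotProduct, ← Finset.sum_sub_distrib]
    refine Finset.sum_congr rfl fun i _ => ?_
    split_ifs <;> simp
  have hinner : star ψ ⬝ᵥ (fun i => (if S i then (-a : ℂ) else b) * ψ i) =
      ((-a * p + b * (1 - p) : ℝ) : ℂ) := by
    have : star ψ ⬝ᵥ (fun i => (if S i then (-a : ℂ) else b) * ψ i) =
        -a * (∑ i, if S i then star (ψ i) * ψ i else 0) +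
          b * (∑ i, if S i then 0 else star (ψ i) * ψ i) := by
      rw [dotProduct, Finset.mul_sum, Finset.mul_sum, ← Finset.sum_add_distrib]
      refine Finset.sum_congr rfl fun i _ => ?_
      rw [Pi.star_apply]
      split_ifs <;> ring
    rw [this, hp, hp']
    push_cast
    ring
  have hS : (diagonal fun i => if S i then (-1 : ℂ) else 1) *ᵥ
      (fun i => (if S i then (a : ℂ) else b) * ψ i) =
      fun i => (if S i then (-a : ℂ) else b) * ψ i := by
    ext i
    rw [mulVec_diagonal]
    split_ifs <;> ring
  rw [groverOp, ← mulVec_mulVec, ← mulVec_mulVec, ← mulVec_mulVec, hS, hrefl, hinner]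
  ext i
  simp only [Pi.sub_apply, Pi.smul_apply, smul_eq_mul]
  split_ifs <;> push_cast <;> ring

/-- The angle relations are stated as products, which keeps them meaningful when sin φ or cos φ is
zero. -/
theorem exists_grover_coefficients {ι : Type} [Fintype ι] [DecidableEq ι] {A : Matrix ι ι ℂ}
    (hA : A ∈ unitaryGroup ι ℂ) (i₀ : ι) (S : ι → Prop) [DecidablePred S] (φ : ℝ)
    (hφ : Real.sin φ ^ 2 = ∑ i, if S i then ‖(A *ᵥ Pi.single i₀ 1) i‖ ^ 2 else 0) (k : ℕ) :
    ∃ a b : ℝ, a * Real.sin φ = Real.sin ((2 * k + 1) * φ) ∧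
      b * Real.cos φ = Real.cos ((2 * k + 1) * φ) ∧
      (groverOp A i₀ S ^ k * A) *ᵥ Pi.single i₀ 1 =
        fun i => (if S i then (a : ℂ) else b) * (A *ᵥ Pi.single i₀ 1) i := by
  induction k with
  | zero =>
    refine ⟨1, 1, by simp, by simp, ?_⟩
    ext i
    simp
  | succ k ih =>
    obtain ⟨a, b, ha, hb, hab⟩ := ih
    have hc : Real.cos φ ^ 2 = 1 - Real.sin φ ^ 2 := by rw [← Real.sin_sq_add_cos_sq φ]; ring
    have e1 : (2 * ((k + 1 : ℕ) : ℝ) + 1) * φ = (2 * k + 1) * φ + 2 * φ := by push_cast; ring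
    refine ⟨(1 - 2 * Real.sin φ ^ 2) * a + 2 * (1 - Real.sin φ ^ 2) * b,
      (1 - 2 * Real.sin φ ^ 2) * b - 2 * Real.sin φ ^ 2 * a, ?_, ?_, ?_⟩
    · rw [e1, Real.sin_add, ← ha, ← hb, Real.cos_two_mul, Real.sin_two_mul, ← hc]
      linear_combination (-2 * a * Real.sin φ) * hc
    · rw [e1, Real.cos_add, ← ha, ← hb, Real.cos_two_mul, Real.sin_two_mul]
      linear_combination (-2 * b * Real.cos φ) * hc
    · rw [pow_succ', Matrix.mul_assoc, ← mulVec_mulVec, hab, groverOp_mulVec hA i₀ S a b]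
      simp only [hφ]

theorem sum_norm_sq_grover {ι : Type} [Fintype ι] [DecidableEq ι] {A : Matrix ι ι ℂ}
    (hA : A ∈ unitaryGroup ι ℂ) (i₀ : ι) (S : ι → Prop) [DecidablePred S] (φ : ℝ)
    (hφ : Real.sin φ ^ 2 = ∑ i, if S i then ‖(A *ᵥ Pi.single i₀ 1) i‖ ^ 2 else 0) (k : ℕ) :
    (∑ i, if S i then ‖((groverOp A i₀ S ^ k * A) *ᵥ Pi.single i₀ 1) i‖ ^ 2 else 0) =
      Real.sin ((2 * k + 1) * φ) ^ 2 := by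
  obtain ⟨a, b, ha, hb, hab⟩ := exists_grover_coefficients hA i₀ S φ hφ k
  rw [← ha, mul_pow, hφ, Finset.mul_sum, hab]
  refine Finset.sum_congr rfl fun i _ => ?_
  by_cases hS : S i
  · simp [hS, mul_pow]
  · simp [hS]

/-- Each iterate uses `F U` and its adjoint once, that is 2d queries, on top of d for the
preparation. -/
theorem Realizes.grover {d : ℕ} {F : Unitaries (Sys n m) → Matrix (Sys n m × Y) (Sys n m × Y) ℂ}
    (h : Realizes Y d F) (i₀ : Sys n m × Y) (S : Sys n m × Y → Prop) [DecidablePred S] (k : ℕ) :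
    Realizes Y ((2 * k + 1) * d) (fun U => groverOp (F U) i₀ S ^ k * F U) := by
  have h1 : Realizes Y d (fun U => (F U)ᴴ * diagonal fun i => if S i then (-1 : ℂ) else 1) := by
    have hS : (diagonal fun i => if S i then (-1 : ℂ) else 1) ∈ unitaryGroup (Sys n m × Y) ℂ := by
      simpa only [ite_not] using signDiagonal_mem (fun i => ¬ S i)
    simpa using h.conjTranspose.mul (Realizes.gate ⟨_, hS⟩)
  have h2 := ((h.mul (h1.gate_mul _ (rankOne_reflection_mem i₀))).pow k).mul h
  have e : (2 * k + 1) * d = k * (d + d) + d := by ring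
  rw [e]
  exact h2

end Amplification

/-- The workspace of `w + 1` qubits, split into registers. -/
def workspaceEquiv (n m k : ℕ) : Qubits (n + m + k + 1) ≃ Sys n m × (Fin 2 × Qubits k) :=
  ((Fin.consEquiv (fun _ => Fin 2)).symm.trans
    ((Equiv.refl _).prodCongr ((Fin.appendEquiv (n + m) k).symm.trans
      ((Fin.appendEquiv n m).symm.prodCongr (Equiv.refl _))))).trans
    ⟨fun x => (x.2.1, (x.1, x.2.2)), fun x => (x.2.1, (x.1, x.2.2)), fun _ => rfl, fun _ => rfl⟩

theorem workspaceEquiv_bit (n m k : ℕ) (x : Qubits (n + m + k + 1)) :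
    (workspaceEquiv n m k x).2.1 = x 0 := rfl

theorem workspaceEquiv_zero (n m k : ℕ) : workspaceEquiv n m k 0 = 0 := rfl

/-- A function `g` with values in `[0,1]` that is certified by sums of squares of degree `d` gives,
after `k` rounds of amplitude amplification, a circuit with `(2 k + 1)(2 d + 1)` queries. -/
theorem exists_amplified_circuit {d : ℕ} {g : ℂ → ℝ} (hg : IsSOS d g)
    (hg' : IsSOS d (fun z => 1 - g z)) (k : ℕ) :
    ∃ c : QueryCircuit n m, c.queries = (2 * k + 1) * (2 * d + 1) ∧
      ∀ (U : Unitaries (Sys n m)) (h : (oracleState U).IsHermitian),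
        (∀ i, 0 ≤ h.eigenvalues i) → (∀ i, h.eigenvalues i ≤ 1) →
        ∀ φ, Real.sin φ ^ 2 = coinProb h g →
          c.outcomeProb U 1 = Real.sin ((2 * k + 1) * φ) ^ 2 ∧
          c.outcomeProb U 0 = 1 - Real.sin ((2 * k + 1) * φ) ^ 2 := by
  obtain ⟨r, F, hF, hF'⟩ := exists_realizes_coin (n := n) (m := m) hg hg'
  have hG := hF.grover (0, 0) (fun x => x.2.2.1 = 1) k
  obtain ⟨c, hc, hc'⟩ := hG.exists_circuit (workspaceEquiv n m r) (fun y => y.2.1)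
    (workspaceEquiv_bit n m r)
  refine ⟨c, hc, fun U h h0 h1 φ hφ => ?_⟩
  rw [← hF' U h h0 h1] at hφ
  have hone := sum_norm_sq_grover (hF.mem_unitary U) (0, 0) (fun x => x.2.2.1 = 1) φ hφ k
  have e1 : c.outcomeProb U 1 = Real.sin ((2 * k + 1) * φ) ^ 2 := by
    rw [hc', workspaceEquiv_zero, hone]
  refine ⟨e1, ?_⟩
  rw [← e1, eq_sub_iff_add_eq, hc', hc', workspaceEquiv_zero, ← Finset.sum_add_distrib]
  have hn : ∀ V ∈ unitaryGroup (Sys n m × (Sys n m × (Fin 2 × Qubits r))) ℂ,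
      ∑ x, ‖(V *ᵥ Pi.single (0, 0) 1) x‖ ^ 2 = 1 := by
    intro V hV
    apply Complex.ofReal_injective
    rw [sum_norm_sq_eq_dotProduct, star_mulVec, ← dotProduct_mulVec, mulVec_mulVec,
      ← star_eq_conjTranspose, mem_unitaryGroup_iff'.mp hV, one_mulVec]
    simp
  rw [← hn _ (hG.mem_unitary U)]
  refine Finset.sum_congr rfl fun x _ => ?_
  have : x.2.2.1 = 0 ∨ x.2.2.1 = 1 := by
    generalize x.2.2.1 = b
    fin_cases b <;> simp
  rcases this with h | h <;> simp [h]

end QEntropy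

namespace QEntropy

/-! ### Calculus of certificates -/

section Cone

open Polynomial

theorem IsSOS.congr {d : ℕ} {g g' : ℂ → ℝ} (h : IsSOS d g) (e : ∀ z : ℂ, ‖z‖ = 1 → g' z = g z) :
    IsSOS d g' := by
  obtain ⟨ι, _, Q, hQ, h⟩ := h
  exact ⟨ι, _, Q, hQ, fun z hz => (e z hz).trans (h z hz)⟩

theorem IsSOS.mono {d d' : ℕ} {g : ℂ → ℝ} (h : IsSOS d g) (hd : d ≤ d') : IsSOS d' g := by
  obtain ⟨ι, _, Q, hQ, h⟩ := h
  exact ⟨ι, _, Q, fun i => (hQ i).trans hd, h⟩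

theorem IsSOS.add {d : ℕ} {g g' : ℂ → ℝ} (h : IsSOS d g) (h' : IsSOS d g') :
    IsSOS d (fun z => g z + g' z) := by
  obtain ⟨ι, _, Q, hQ, h⟩ := h
  obtain ⟨ι', _, Q', hQ', h'⟩ := h'
  refine ⟨ι ⊕ ι', inferInstance, Sum.elim Q Q', ?_, fun z hz => ?_⟩
  · rintro (i | i)
    · exact hQ i
    · exact hQ' i
  · simp [h z hz, h' z hz]

theorem IsSOS.mul {d d' : ℕ} {g g' : ℂ → ℝ} (h : IsSOS d g) (h' : IsSOS d' g') :
    IsSOS (d + d') (fun z => g z * g' z) := by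
  obtain ⟨ι, _, Q, hQ, h⟩ := h
  obtain ⟨ι', _, Q', hQ', h'⟩ := h'
  refine ⟨ι × ι', inferInstance, fun x => Q x.1 * Q' x.2, fun x => ?_, fun z hz => ?_⟩
  · exact natDegree_mul_le.trans (add_le_add (hQ _) (hQ' _))
  · simp [h z hz, h' z hz, Fintype.sum_prod_type, Finset.sum_mul_sum, mul_pow]

theorem isSOS_norm_sq {d : ℕ} (p : ℂ[X]) (hp : p.natDegree ≤ d) :
    IsSOS d (fun z => ‖p.eval z‖ ^ 2) :=
  ⟨Unit, inferInstance, fun _ => p, fun _ => hp, fun z _ => by simp⟩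

theorem isSOS_const {d : ℕ} {c : ℝ} (hc : 0 ≤ c) : IsSOS d (fun _ => c) := by
  refine (isSOS_norm_sq (d := d) (C ((√c : ℝ) : ℂ)) (by simp)).congr fun z _ => ?_
  simp [Real.sq_sqrt hc]

theorem IsSOS.const_mul {d : ℕ} {g : ℂ → ℝ} {c : ℝ} (hc : 0 ≤ c) (h : IsSOS d g) :
    IsSOS d (fun z => c * g z) := by
  simpa using (isSOS_const (d := 0) hc).mul h

theorem IsSOS.sum {d K : ℕ} {g : ℕ → ℂ → ℝ} (h : ∀ k < K, IsSOS d (g k)) :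
    IsSOS d (fun z => ∑ k ∈ Finset.range K, g k z) := by
  induction K with
  | zero => simpa using isSOS_const (d := d) le_rfl
  | succ K ih =>
    simp only [Finset.sum_range_succ]
    exact (ih fun k hk => h k (by omega)).add (h K (by omega))

theorem norm_add_one_sq {u : ℂ} (hu : ‖u‖ = 1) : ‖1 + u‖ ^ 2 = 2 * (1 + u.re) := by
  rw [← Complex.normSq_eq_norm_sq, Complex.normSq_apply]
  have : u.re * u.re + u.im * u.im = 1 := by
    rw [← Complex.normSq_apply, Complex.normSq_eq_norm_sq, hu]; norm_num
  simp
  linear_combination this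

/-- A trigonometric polynomial is dominated by the sum of the moduli of its coefficients. -/
theorem isSOS_add_sum_re {d K : ℕ} {B : ℝ} {a : ℕ → ℝ} {p : ℕ → ℂ[X]} (ha : ∀ k, 0 ≤ a k)
    (hB : ∑ k ∈ Finset.range K, a k ≤ B) (hp : ∀ k < K, (p k).natDegree ≤ d)
    (hp1 : ∀ k, ∀ z : ℂ, ‖z‖ = 1 → ‖(p k).eval z‖ = 1) :
    IsSOS d (fun z => B + ∑ k ∈ Finset.range K, a k * ((p k).eval z).re) := by
  -- For |u| = 1 one has 1 + Re u = |1 + u|²/2, so each term, completed by its own coefficient, is a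
  -- square.
  have h1 : IsSOS d (fun z => ∑ k ∈ Finset.range K, a k / 2 * ‖(1 + p k).eval z‖ ^ 2) :=
    IsSOS.sum fun k hk => IsSOS.const_mul (div_nonneg (ha k) two_pos.le)
      (isSOS_norm_sq _ ((natDegree_add_le _ _).trans (by simp [hp k hk])))
  refine (h1.add (isSOS_const (sub_nonneg.mpr hB))).congr fun z hz => ?_
  have : ∀ k, a k / 2 * ‖(1 + p k).eval z‖ ^ 2 = a k + a k * ((p k).eval z).re := by
    intro k
    rw [eval_add, eval_one, norm_add_one_sq (hp1 k z hz)]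
    ring
  simp only [this, Finset.sum_add_distrib]
  ring

/-- Both `g` and `B - g` are sums of squares of degree `d`. -/
def Coin (d : ℕ) (B : ℝ) (g : ℂ → ℝ) : Prop := IsSOS d g ∧ IsSOS d (fun z => B - g z)

theorem Coin.mono {d d' : ℕ} {B : ℝ} {g : ℂ → ℝ} (h : Coin d B g) (hd : d ≤ d') : Coin d' B g :=
  ⟨h.1.mono hd, h.2.mono hd⟩

theorem Coin.add {d : ℕ} {B B' : ℝ} {g g' : ℂ → ℝ} (h : Coin d B g) (h' : Coin d B' g') :
    Coin d (B + B') (fun z => g z + g' z) :=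
  ⟨h.1.add h'.1, (h.2.add h'.2).congr fun z _ => by ring⟩

theorem Coin.const_mul {d : ℕ} {B c : ℝ} {g : ℂ → ℝ} (hc : 0 ≤ c) (h : Coin d B g) :
    Coin d (c * B) (fun z => c * g z) :=
  ⟨h.1.const_mul hc, (h.2.const_mul hc).congr fun z _ => by ring⟩

theorem coin_const {d : ℕ} {B c : ℝ} (hc : 0 ≤ c) (hB : c ≤ B) : Coin d B (fun _ => c) :=
  ⟨isSOS_const hc, isSOS_const (sub_nonneg.mpr hB)⟩

theorem coin_sum_re {d K : ℕ} {B : ℝ} {a : ℕ → ℝ} {p : ℕ → ℂ[X]} (ha : ∀ k, 0 ≤ a k)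
    (hB : ∑ k ∈ Finset.range K, a k ≤ B) (hp : ∀ k < K, (p k).natDegree ≤ d)
    (hp1 : ∀ k, ∀ z : ℂ, ‖z‖ = 1 → ‖(p k).eval z‖ = 1) :
    Coin d (2 * B) (fun z => B + ∑ k ∈ Finset.range K, a k * ((p k).eval z).re) := by
  refine ⟨isSOS_add_sum_re ha hB hp hp1, ?_⟩
  refine (isSOS_add_sum_re (p := fun k => -p k) ha hB (fun k hk => by simpa using hp k hk)
    fun k z hz => by simpa using hp1 k z hz).congr fun z _ => ?_
  simp only [eval_neg, Complex.neg_re, mul_neg, Finset.sum_neg_distrib]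
  ring

/-- A polynomial whose modulus on the circle is at most `1`, certified by a sum of squares. -/
def IsContractive (d : ℕ) (p : ℂ[X]) : Prop :=
  p.natDegree ≤ d ∧ IsSOS d (fun z => 1 - ‖p.eval z‖ ^ 2)

/-- The identity 1 - |tu + (1-t)v|² = t(1 - |u|²) + (1-t)(1 - |v|²) + t(1-t)|u - v|² shows the
certificate. -/
theorem IsContractive.convex {d : ℕ} {p q : ℂ[X]} {t : ℝ} (h0 : 0 ≤ t) (h1 : t ≤ 1)
    (hp : IsContractive d p) (hq : IsContractive d q) :
    IsContractive d (C (t : ℂ) * p + C ((1 - t : ℝ) : ℂ) * q) := by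
  have h1' : 0 ≤ 1 - t := sub_nonneg.mpr h1
  refine ⟨(natDegree_add_le _ _).trans (max_le ((natDegree_C_mul_le _ _).trans hp.1)
    ((natDegree_C_mul_le _ _).trans hq.1)), ?_⟩
  refine (((hp.2.const_mul h0).add (hq.2.const_mul h1')).add
    ((isSOS_norm_sq (p - q) ((natDegree_sub_le _ _).trans (max_le hp.1 hq.1))).const_mul
      (mul_nonneg h0 h1'))).congr fun z _ => ?_
  simp only [eval_add, eval_mul, eval_C, eval_sub]
  generalize p.eval z = u
  generalize q.eval z = v
  simp only [← Complex.normSq_eq_norm_sq, Complex.normSq_apply, Complex.add_re, Complex.add_im,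
    Complex.sub_re, Complex.sub_im, Complex.mul_re, Complex.mul_im, Complex.ofReal_re,
    Complex.ofReal_im]
  ring

theorem IsContractive.mul_of_norm_one {d d' : ℕ} {p q : ℂ[X]} (hp : IsContractive d p)
    (hq : q.natDegree ≤ d') (hq1 : ∀ z : ℂ, ‖z‖ = 1 → ‖q.eval z‖ = 1) :
    IsContractive (d' + d) (q * p) := by
  refine ⟨natDegree_mul_le.trans (add_le_add hq hp.1),
    (hp.2.mono (by omega)).congr fun z hz => ?_⟩
  rw [eval_mul, norm_mul, hq1 z hz, one_mul]

theorem isContractive_one {d : ℕ} : IsContractive d 1 :=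
  ⟨by simp, (isSOS_const le_rfl).congr fun z _ => by simp⟩

end Cone

/-! ### Logarithm of a bias from coin tosses -/

section CoinExpectation

/-- The expectation of `h` of the number of heads in `N` tosses of a coin of bias `q`. -/
def coinExp (q : ℝ) : ℕ → (ℕ → ℝ) → ℝ
  | 0, h => h 0
  | N + 1, h => q * coinExp q N (fun j => h (j + 1)) + (1 - q) * coinExp q N h

variable {q : ℝ}

theorem coinExp_add (N : ℕ) : ∀ h h' : ℕ → ℝ,
    coinExp q N (fun j => h j + h' j) = coinExp q N h + coinExp q N h' := by
  induction N with
  | zero => intro h h'; rfl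
  | succ N ih => intro h h'; simp only [coinExp, ih]; ring

theorem coinExp_const_mul (c : ℝ) (N : ℕ) : ∀ h : ℕ → ℝ,
    coinExp q N (fun j => c * h j) = c * coinExp q N h := by
  induction N with
  | zero => intro h; rfl
  | succ N ih => intro h; simp only [coinExp, ih]; ring

theorem coinExp_const (c : ℝ) (N : ℕ) : coinExp q N (fun _ => c) = c := by
  induction N with
  | zero => rfl
  | succ N ih => simp only [coinExp, ih]; ring

theorem coinExp_sub (N : ℕ) (h h' : ℕ → ℝ) :
    coinExp q N (fun j => h j - h' j) = coinExp q N h - coinExp q N h' := by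
  have := coinExp_add (q := q) N (fun j => h j - h' j) h'
  simp only [sub_add_cancel] at this
  linarith

theorem coinExp_mono (h0 : 0 ≤ q) (h1 : q ≤ 1) (N : ℕ) : ∀ h h' : ℕ → ℝ,
    (∀ j ≤ N, h j ≤ h' j) → coinExp q N h ≤ coinExp q N h' := by
  induction N with
  | zero => intro h h' hh; exact hh 0 le_rfl
  | succ N ih =>
    intro h h' hh
    exact add_le_add
      (mul_le_mul_of_nonneg_left (ih _ _ fun j hj => hh _ (by omega)) h0)
      (mul_le_mul_of_nonneg_left (ih _ _ fun j hj => hh _ (by omega)) (sub_nonneg.mpr h1))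

theorem coinExp_pow (a : ℝ) (N : ℕ) : coinExp q N (fun j => a ^ j) = (1 - q + q * a) ^ N := by
  induction N with
  | zero => simp [coinExp]
  | succ N ih =>
    have : (fun j => a ^ (j + 1)) = fun j => a * a ^ j := by ext j; ring
    simp only [coinExp, this, coinExp_const_mul, ih]
    ring

theorem coinExp_indicator_zero (N : ℕ) :
    coinExp q N (fun j => if j = 0 then 1 else 0) = (1 - q) ^ N := by
  induction N with
  | zero => simp [coinExp]
  | succ N ih =>
    simp only [coinExp, ih, Nat.succ_ne_zero, if_false, coinExp_const]
    ring

/-- Size biasing of the binomial law, from j·C(N+1, j) = (N+1)·C(N, j-1). -/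
theorem coinExp_mul_size (N : ℕ) : ∀ h : ℕ → ℝ,
    coinExp q (N + 1) (fun j => j * h j) = (N + 1) * q * coinExp q N (fun j => h (j + 1)) := by
  induction N with
  | zero => intro h; simp [coinExp]
  | succ N ih =>
    intro h
    have e : (fun j : ℕ => ((j + 1 : ℕ) : ℝ) * h (j + 1)) =
        fun j : ℕ => (j : ℝ) * h (j + 1) + h (j + 1) := by
      ext j; push_cast; ring
    rw [coinExp, e, coinExp_add, ih h, ih (fun j => h (j + 1))]
    simp only [coinExp]
    push_cast
    ring

/-- Partial sums of the harmonic series. -/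
noncomputable def harm (N : ℕ) : ℝ := ∑ i ∈ Finset.range N, 1 / ((i : ℝ) + 1)

theorem harm_succ (N : ℕ) : harm (N + 1) = harm N + 1 / ((N : ℝ) + 1) :=
  Finset.sum_range_succ _ _

/-- The unbiased estimator of the truncated logarithmic series. -/
theorem coinExp_harm (N : ℕ) : coinExp q N (fun j => harm N - harm j) =
    ∑ k ∈ Finset.range N, (1 - q) ^ (k + 1) / ((k : ℝ) + 1) := by
  induction N with
  | zero => simp [coinExp]
  | succ N ih =>
    -- Size biasing applied to 1/j; the product j·(1/j) is 1 except at j = 0, where division by zero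
    -- makes it 0.
    have hinv : q * coinExp q N (fun j => 1 / ((j : ℝ) + 1)) =
        (1 - (1 - q) ^ (N + 1)) / ((N : ℝ) + 1) := by
      have h1 := coinExp_mul_size (q := q) N (fun j => 1 / (j : ℝ))
      have e : (fun j : ℕ => (j : ℝ) * (1 / (j : ℝ))) =
          fun j : ℕ => 1 - (if j = 0 then (1 : ℝ) else 0) := by
        ext j
        rcases eq_or_ne j 0 with rfl | hj
        · simp
        · simp [hj]
      rw [e, coinExp_sub, coinExp_const, coinExp_indicator_zero] at h1
      rw [h1]
      push_cast
      field_simp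
    have e1 : (fun j => harm (N + 1) - harm (j + 1)) =
        fun j => (harm N - harm j + 1 / ((N : ℝ) + 1)) - 1 / ((j : ℝ) + 1) := by
      ext j; rw [harm_succ, harm_succ]; ring
    have e2 : (fun j => harm (N + 1) - harm j) =
        fun j => (harm N - harm j) + 1 / ((N : ℝ) + 1) := by
      ext j; rw [harm_succ]; ring
    rw [coinExp, e1, e2, coinExp_sub, coinExp_add, coinExp_const, ih, mul_sub, hinv,
      Finset.sum_range_succ]
    field_simp
    ring

theorem harm_sub_nonneg {j N : ℕ} (h : j ≤ N) : 0 ≤ harm N - harm j :=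
  sub_nonneg.mpr (Finset.sum_le_sum_of_subset_of_nonneg (Finset.range_mono h)
    fun i _ _ => by positivity)

theorem harm_sub_le {j N N₀ : ℕ} (h0 : 0 < N₀) (hj : N₀ ≤ j) (h : j ≤ N) :
    harm N - harm j ≤ N / N₀ := by
  have h0' : (0 : ℝ) < N₀ := by exact_mod_cast h0
  rw [harm, harm, ← Finset.sum_Ico_eq_sub _ h]
  calc ∑ i ∈ Finset.Ico j N, 1 / ((i : ℝ) + 1) ≤ ∑ i ∈ Finset.Ico j N, 1 / (N₀ : ℝ) := by
        refine Finset.sum_le_sum fun i hi => one_div_le_one_div_of_le h0' ?_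
        have := (Finset.mem_Ico.mp hi).1
        have : N₀ ≤ i := hj.trans this
        have : (N₀ : ℝ) ≤ i := by exact_mod_cast this
        linarith
    _ = ((N - j : ℕ) : ℝ) / N₀ := by simp [div_eq_mul_inv]
    _ ≤ N / N₀ := by
        refine div_le_div_of_nonneg_right ?_ h0'.le
        exact_mod_cast Nat.sub_le _ _

theorem harm_le (N : ℕ) : harm N ≤ N := by
  refine (Finset.sum_le_sum (g := fun _ => (1 : ℝ)) fun i _ => ?_).trans (by simp)
  rw [div_le_one (by positivity)]
  linarith [(Nat.cast_nonneg i : (0 : ℝ) ≤ i)]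

/-- The clamped logarithm estimator. -/
noncomputable def logEstimator (N N₀ j : ℕ) : ℝ := if N₀ ≤ j then harm N - harm j else 0

/-- Clamping keeps the estimator bounded by 32, but changes it only when fewer than 8l of the 256l
tosses are heads. For q ≥ 1/16 the mean number is at least 16l, so this is exponentially rare; the
truncation of the series is exponentially small as well. -/
theorem abs_coinExp_logEstimator_add_log (h0 : 1 / 16 ≤ q) (h1 : q ≤ 1) (l : ℕ) (hl : 1 ≤ l) :
    |coinExp q (256 * l) (logEstimator (256 * l) (8 * l)) + Real.log q| ≤
      272 * Real.exp (-(l : ℝ)) := by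
  have hl' : (1 : ℝ) ≤ l := by exact_mod_cast hl
  have hq0 : 0 ≤ q := by linarith
  set N := 256 * l with hN
  have hNr : (N : ℝ) = 256 * l := by rw [hN]; push_cast; ring
  have e1 : |coinExp q N (fun j => harm N - harm j) - coinExp q N (logEstimator N (8 * l))| ≤
      256 * Real.exp (-(l : ℝ)) := by
    rw [← coinExp_sub]
    have hlow : 0 ≤ coinExp q N (fun j => harm N - harm j - logEstimator N (8 * l) j) := by
      rw [← coinExp_const (q := q) 0 N]
      refine coinExp_mono hq0 h1 N _ _ fun j hj => ?_
      unfold logEstimator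
      split_ifs
      · simp
      · simpa using harm_sub_nonneg hj
    rw [abs_of_nonneg hlow]
    -- Chernoff bound: the indicator of j < 8l is at most 2^{8l}·2^{-j}.
    have hup : coinExp q N (fun j => harm N - harm j - logEstimator N (8 * l) j) ≤
        coinExp q N (fun j => (N * 2 ^ (8 * l)) * (1 / 2 : ℝ) ^ j) := by
      refine coinExp_mono hq0 h1 N _ _ fun j hj => ?_
      unfold logEstimator
      split_ifs with hj'
      · simp only [sub_self]; positivity
      · have h2 : (1 : ℝ) ≤ 2 ^ (8 * l) * (1 / 2) ^ j := by
          rw [one_div, inv_pow, ← div_eq_mul_inv, one_le_div (by positivity)]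
          exact pow_le_pow_right₀ (by norm_num) (by omega)
        have h3 : (0 : ℝ) ≤ harm j := Finset.sum_nonneg fun i _ => by positivity
        have h4 := harm_le N
        have h5 : (0 : ℝ) ≤ N := Nat.cast_nonneg N
        nlinarith
    refine hup.trans ?_
    rw [coinExp_const_mul, coinExp_pow]
    have hb : (1 - q + q * (1 / 2)) ^ N ≤ Real.exp (-(8 * l : ℝ)) := by
      have : 1 - q + q * (1 / 2) ≤ Real.exp (-(1 / 32 : ℝ)) := by
        have := Real.add_one_le_exp (-(1 / 32 : ℝ))
        linarith
      calc (1 - q + q * (1 / 2)) ^ N ≤ Real.exp (-(1 / 32 : ℝ)) ^ N :=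
            pow_le_pow_left₀ (by linarith) this N
        _ = Real.exp (-(8 * l : ℝ)) := by
            rw [← Real.exp_nat_mul, hNr]; congr 1; ring
    -- Against the moment bound e^{-8l}, the factor 2^{8l} ≤ e^{6l} leaves e^{-2l}, and N = 256l ≤
    -- 256e^l costs one more power.
    have h256 : (2 : ℝ) ^ (8 * l) ≤ Real.exp (6 * l) := by
      rw [pow_mul, show (6 * l : ℝ) = l * 6 by ring, Real.exp_nat_mul]
      refine pow_le_pow_left₀ (by norm_num) ?_ l
      have h27 : (2.7 : ℝ) ≤ Real.exp 1 := by linarith [Real.exp_one_gt_d9]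
      have : Real.exp 6 = Real.exp 1 ^ 6 := by rw [← Real.exp_nat_mul]; norm_num
      rw [this]
      calc (2 : ℝ) ^ 8 ≤ 2.7 ^ 6 := by norm_num
        _ ≤ _ := pow_le_pow_left₀ (by norm_num) h27 6
    have hlexp : (l : ℝ) ≤ Real.exp l := by linarith [Real.add_one_le_exp (l : ℝ)]
    calc (N : ℝ) * 2 ^ (8 * l) * (1 - q + q * (1 / 2)) ^ N
        ≤ (256 * Real.exp l) * Real.exp (6 * l) * Real.exp (-(8 * l : ℝ)) := by
          rw [hNr]
          gcongr
      _ = 256 * Real.exp (-(l : ℝ)) := by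
          rw [mul_assoc, mul_assoc, ← Real.exp_add, ← Real.exp_add]
          congr 2
          ring
  have e2 : |coinExp q N (fun j => harm N - harm j) + Real.log q| ≤
      16 * Real.exp (-(l : ℝ)) := by
    have hy : |1 - q| < 1 := by rw [abs_lt]; constructor <;> linarith
    have := Real.abs_log_sub_add_sum_range_le hy N
    rw [sub_sub_cancel] at this
    rw [coinExp_harm]
    refine this.trans ?_
    rw [abs_of_nonneg (by linarith : (0 : ℝ) ≤ 1 - q), sub_sub_cancel]
    have hb : (1 - q) ^ (N + 1) ≤ Real.exp (-(l : ℝ)) := by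
      calc (1 - q) ^ (N + 1) ≤ (1 - q) ^ N :=
            pow_le_pow_of_le_one (by linarith) (by linarith) (by omega)
        _ ≤ Real.exp (-(1 / 16 : ℝ)) ^ N := by
            refine pow_le_pow_left₀ (by linarith) ?_ N
            have := Real.add_one_le_exp (-(1 / 16 : ℝ))
            linarith
        _ = Real.exp (-(16 * l : ℝ)) := by
            rw [← Real.exp_nat_mul, hNr]; congr 1; ring
        _ ≤ Real.exp (-(l : ℝ)) := Real.exp_le_exp.mpr (by linarith)
    rw [div_le_iff₀ (by linarith)]
    have := Real.exp_pos (-(l : ℝ))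
    nlinarith
  rw [abs_le] at *
  constructor <;> linarith

/-- For nonnegative `h` the expectation is a polynomial in g and 1 - g with nonnegative
coefficients. -/
theorem isSOS_coinExp {d : ℕ} {g : ℂ → ℝ} (hg : Coin d 1 g) (N : ℕ) : ∀ h : ℕ → ℝ,
    (∀ j ≤ N, 0 ≤ h j) → IsSOS (N * d) (fun z => coinExp (g z) N h) := by
  induction N with
  | zero => intro h hh; exact isSOS_const (hh 0 le_rfl)
  | succ N ih =>
    intro h hh
    rw [Nat.succ_mul, add_comm]
    exact (hg.1.mul (ih _ fun j hj => hh _ (by omega))).add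
      (hg.2.mul (ih _ fun j hj => hh _ (by omega)))

theorem coin_coinExp {d : ℕ} {g : ℂ → ℝ} (hg : Coin d 1 g) (N : ℕ) {B : ℝ} (h : ℕ → ℝ)
    (hh : ∀ j ≤ N, 0 ≤ h j ∧ h j ≤ B) : Coin (N * d) B (fun z => coinExp (g z) N h) := by
  refine ⟨isSOS_coinExp hg N h fun j hj => (hh j hj).1, ?_⟩
  refine (isSOS_coinExp hg N (fun j => B - h j) fun j hj => sub_nonneg.mpr (hh j hj).2).congr
    fun z _ => ?_
  rw [coinExp_sub, coinExp_const]

end CoinExpectation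

end QEntropy

/-! ### Certified approximation of the logarithm -/

namespace QEntropy

open Polynomial

theorem abs_sum_re_add_log_norm_le {u : ℂ} (hu : ‖u‖ < 1) (K : ℕ) :
    |∑ k ∈ Finset.range K, (u ^ (k + 1)).re / ((k : ℝ) + 1) + Real.log ‖1 - u‖| ≤
      ‖u‖ ^ (K + 1) * (1 - ‖u‖)⁻¹ / (K + 1) := by
  have h := Complex.norm_log_sub_logTaylor_le K (z := -u) (by rwa [norm_neg])
  rw [norm_neg] at h
  have hT : Complex.logTaylor (K + 1) (-u) =
      -∑ k ∈ Finset.range K, u ^ (k + 1) / (((k : ℝ) + 1 : ℝ) : ℂ) := by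
    rw [Complex.logTaylor, Finset.sum_range_succ', ← Finset.sum_neg_distrib]
    simp only [Nat.cast_zero, div_zero, add_zero]
    refine Finset.sum_congr rfl fun k _ => ?_
    rw [neg_pow u (k + 1), ← mul_assoc, ← pow_add,
      Odd.neg_one_pow ⟨k + 1, by ring⟩]
    push_cast
    ring
  have hre : ∑ k ∈ Finset.range K, (u ^ (k + 1)).re / ((k : ℝ) + 1) + Real.log ‖1 - u‖ =
      (Complex.log (1 + -u) - Complex.logTaylor (K + 1) (-u)).re := by
    rw [hT, sub_neg_eq_add, Complex.add_re, Complex.log_re, Complex.re_sum, add_comm,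
      ← sub_eq_add_neg]
    congr 1
    exact Finset.sum_congr rfl fun k _ => (Complex.div_ofReal_re _ _).symm
  rw [hre]
  exact (Complex.abs_re_le_norm _).trans h

theorem sum_pow_div_le {r : ℝ} (h0 : 0 ≤ r) (h1 : r < 1) (K : ℕ) :
    ∑ k ∈ Finset.range K, r ^ (k + 1) / ((k : ℝ) + 1) ≤ -Real.log (1 - r) :=
  sum_le_hasSum _ (fun k _ => by positivity)
    (Real.hasSum_pow_div_log_of_abs_lt_one (by rwa [abs_of_nonneg h0]))

/-- Coefficients of `1 - (1 - ζ)(1 + rζ + ⋯ + (rζ)^n)`, divided by `ζ`, as a polynomial in `ζ = -z²`.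
-/
noncomputable def kernelAux (r : ℝ) : ℕ → ℂ[X]
  | 0 => 1
  | n + 1 => C ((r : ℝ) : ℂ) * (-X ^ 2 * kernelAux r n) + C ((1 - r : ℝ) : ℂ) * 1

theorem natDegree_neg_X_sq : (-X ^ 2 : ℂ[X]).natDegree ≤ 2 := by simp

theorem norm_eval_neg_X_sq {z : ℂ} (hz : ‖z‖ = 1) : ‖(-X ^ 2 : ℂ[X]).eval z‖ = 1 := by
  simp [hz]

/-- Each step of the recursion is a convex combination of 1 and a unimodular multiple of the
previous polynomial. -/
theorem isContractive_kernelAux {r : ℝ} (h0 : 0 ≤ r) (h1 : r ≤ 1) (n : ℕ) :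
    IsContractive (2 * n) (kernelAux r n) := by
  induction n with
  | zero => exact isContractive_one
  | succ n ih =>
    have := ih.mul_of_norm_one natDegree_neg_X_sq fun z hz => norm_eval_neg_X_sq hz
    rw [mul_add, mul_one, add_comm]
    exact IsContractive.convex h0 h1 this isContractive_one

theorem eval_kernelAux (r : ℝ) (n : ℕ) (z : ℂ) :
    1 - -z ^ 2 * (kernelAux r n).eval z =
      (1 - -z ^ 2) * ∑ k ∈ Finset.range (n + 1), (r * -z ^ 2) ^ k := by
  induction n with
  | zero => simp [kernelAux]
  | succ n ih =>
    have h : (kernelAux r (n + 1)).eval z = r * (-z ^ 2 * (kernelAux r n).eval z) + (1 - r) := by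
      simp [kernelAux]
    have h2 : -z ^ 2 * (kernelAux r n).eval z =
        1 - (1 - -z ^ 2) * ∑ k ∈ Finset.range (n + 1), (r * -z ^ 2) ^ k := by
      rw [← ih]; ring
    rw [h, h2, Finset.sum_range_succ' _ (n + 1)]
    simp only [pow_succ, ← Finset.sum_mul]
    ring

/-- The squared modulus of `(1 - ζ)(1 + rζ + ⋯ + (rζ)^n)/2` at `ζ = -z²`. -/
noncomputable def kernelBias (r : ℝ) (n : ℕ) (z : ℂ) : ℝ :=
  ‖(1 - -z ^ 2) * ∑ k ∈ Finset.range (n + 1), (r * -z ^ 2) ^ k‖ ^ 2 / 4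

/-- Half of (1 - ζ)Σ(rζ)^k is the average of two contractions, 1 and -ζ times the auxiliary
polynomial. -/
theorem coin_kernelBias {r : ℝ} (h0 : 0 ≤ r) (h1 : r ≤ 1) (n : ℕ) :
    Coin (2 * (n + 1)) 1 (kernelBias r n) := by
  have h2 := ((isContractive_kernelAux h0 h1 n).mul_of_norm_one natDegree_neg_X_sq
    fun z hz => norm_eval_neg_X_sq hz).mul_of_norm_one (q := -1) (d' := 0) (by simp)
    fun z _ => by simp
  have h3 := IsContractive.convex (t := 1 / 2) (by norm_num) (by norm_num)
    (isContractive_one (d := 0 + (2 + 2 * n))) h2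
  have he : ∀ z, kernelBias r n z = ‖(C (((1 / 2 : ℝ)) : ℂ) * 1 + C ((1 - 1 / 2 : ℝ) : ℂ) *
      (-1 * (-X ^ 2 * kernelAux r n))).eval z‖ ^ 2 := by
    intro z
    have : (C (((1 / 2 : ℝ)) : ℂ) * 1 + C ((1 - 1 / 2 : ℝ) : ℂ) *
      (-1 * (-X ^ 2 * kernelAux r n))).eval z = (1 - -z ^ 2 * (kernelAux r n).eval z) / 2 := by
      simp
      ring
    rw [this, eval_kernelAux, kernelBias, norm_div, div_pow]
    norm_num
  have hd : 0 + (2 + 2 * n) = 2 * (n + 1) := by ring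
  rw [hd] at h3
  exact ⟨(isSOS_norm_sq _ h3.1).congr fun z _ => he z, h3.2.congr fun z _ => by rw [he z]⟩

/-- On the circle 1 + z² = z(z + z̄). -/
theorem norm_one_add_sq {z : ℂ} (hz : ‖z‖ = 1) : ‖1 - -z ^ 2‖ = 2 * |z.re| := by
  have h : 1 - -z ^ 2 = z * ((2 * z.re : ℝ) : ℂ) := by
    have h1 : z * starRingEnd ℂ z = 1 := by
      rw [Complex.mul_conj, Complex.normSq_eq_norm_sq, hz]; simp
    have h2 := Complex.add_conj z
    rw [← h2]
    linear_combination -h1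
  rw [h, norm_mul, hz, one_mul, Complex.norm_real, Real.norm_eq_abs, abs_mul]
  norm_num

theorem norm_one_sub_mul_sq {r : ℝ} {u : ℂ} (hu : ‖u‖ = 1) :
    ‖1 - r * u‖ ^ 2 = (1 - r) ^ 2 + r * ‖1 - u‖ ^ 2 := by
  have h : u.re * u.re + u.im * u.im = 1 := by
    rw [← Complex.normSq_apply, Complex.normSq_eq_norm_sq, hu]; norm_num
  simp only [← Complex.normSq_eq_norm_sq, Complex.normSq_apply, Complex.sub_re, Complex.sub_im,
    Complex.one_re, Complex.one_im, Complex.mul_re, Complex.mul_im, Complex.ofReal_re,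
    Complex.ofReal_im]
  linear_combination (r ^ 2 - r) * h

/-- By the geometric sum, the square root of the bias is Re z · |1 - (rζ)^{n+1}| / |1 - rζ|; taking
logarithms gives the decomposition. Since n ≥ 1/γ, the power is at most e^{-1}, and Re z ≥ γ makes
|1 - rζ| comparable to Re z, so the bias stays away from zero. -/
theorem kernel_bounds {γ : ℝ} (h0 : 0 < γ) (h1 : γ ≤ 1 / 2) (n : ℕ) (hn : 1 / γ ≤ n) {z : ℂ}
    (hz : ‖z‖ = 1) (hx : γ ≤ z.re) :
    ((1 - γ) ^ (n + 1) ≤ Real.exp (-1)) ∧ 1 / 16 ≤ kernelBias (1 - γ) n z ∧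
    -Real.log z.re = -(1 / 2) * Real.log (kernelBias (1 - γ) n z) +
      Real.log ‖1 - (((1 - γ : ℝ) : ℂ) * -z ^ 2) ^ (n + 1)‖ -
      Real.log ‖1 - ((1 - γ : ℝ) : ℂ) * -z ^ 2‖ := by
  have hx0 : 0 < z.re := h0.trans_le hx
  set r := 1 - γ with hr
  have hr0 : 0 ≤ r := by linarith
  have hr1 : r < 1 := by linarith
  set u : ℂ := -z ^ 2 with hu
  have hu1 : ‖u‖ = 1 := by simp [hu, hz]
  have hpow : r ^ (n + 1) ≤ Real.exp (-1) := by
    have h2 : r ≤ Real.exp (-γ) := by linarith [Real.add_one_le_exp (-γ)]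
    have h3 : 1 ≤ γ * n := by
      rw [div_le_iff₀ h0] at hn; linarith
    calc r ^ (n + 1) ≤ r ^ n := pow_le_pow_of_le_one hr0 hr1.le (by omega)
      _ ≤ Real.exp (-γ) ^ n := pow_le_pow_left₀ hr0 h2 n
      _ = Real.exp (-(γ * n)) := by rw [← Real.exp_nat_mul]; congr 1; ring
      _ ≤ Real.exp (-1) := Real.exp_le_exp.mpr (by linarith)
  have hexp : Real.exp (-1) ≤ 2 / 5 := by
    rw [Real.exp_neg, inv_le_comm₀ (Real.exp_pos 1) (by norm_num)]
    linarith [Real.exp_one_gt_d9]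
  have hru : ‖(r : ℂ) * u‖ = r := by
    rw [norm_mul, hu1, mul_one, Complex.norm_real, Real.norm_eq_abs, abs_of_nonneg hr0]
  have hb : 0 < ‖1 - (r : ℂ) * u‖ := by
    have := norm_sub_norm_le (1 : ℂ) ((r : ℂ) * u)
    rw [hru, norm_one] at this
    linarith
  have hw : 3 / 5 ≤ ‖1 - ((r : ℂ) * u) ^ (n + 1)‖ := by
    have := norm_sub_norm_le (1 : ℂ) (((r : ℂ) * u) ^ (n + 1))
    rw [norm_pow, hru, norm_one] at this
    linarith
  have hone : ‖1 - u‖ = 2 * z.re := by rw [hu, norm_one_add_sq hz, abs_of_pos hx0]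
  have hgeom : ‖∑ k ∈ Finset.range (n + 1), ((r : ℂ) * u) ^ k‖ * ‖1 - (r : ℂ) * u‖ =
      ‖1 - ((r : ℂ) * u) ^ (n + 1)‖ := by
    rw [← norm_mul, geom_sum_mul_neg]
  set S := ‖∑ k ∈ Finset.range (n + 1), ((r : ℂ) * u) ^ k‖ with hS
  set b := ‖1 - (r : ℂ) * u‖ with hbdef
  set w := ‖1 - ((r : ℂ) * u) ^ (n + 1)‖ with hwdef
  have hSpos : 0 < S := by
    by_contra h
    have : S = 0 := le_antisymm (not_lt.mp h) (norm_nonneg _)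
    rw [this, zero_mul] at hgeom
    linarith
  have hq : kernelBias r n z = (z.re * S) ^ 2 := by
    rw [kernelBias, norm_mul, hone]
    ring
  have hb2 : b ^ 2 ≤ 5 * z.re ^ 2 := by
    have h5 := norm_one_sub_mul_sq (r := r) hu1
    rw [hone] at h5
    have h6 : (1 - r) ^ 2 ≤ z.re ^ 2 := by
      rw [hr, sub_sub_cancel]
      exact pow_le_pow_left₀ h0.le hx 2
    have h7 : r * (2 * z.re) ^ 2 ≤ 1 * (2 * z.re) ^ 2 :=
      mul_le_mul_of_nonneg_right hr1.le (sq_nonneg _)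
    rw [hbdef, h5]
    linarith
  -- The lower bound uses (3/5)²/5 = 9/125 ≥ 1/16.
  refine ⟨hpow, ?_, ?_⟩
  · rw [hq]
    have h8 : (S * b) ^ 2 ≤ S ^ 2 * (5 * z.re ^ 2) := by
      rw [mul_pow]; exact mul_le_mul_of_nonneg_left hb2 (sq_nonneg _)
    rw [hgeom] at h8
    have h9 : (3 / 5 : ℝ) ^ 2 ≤ w ^ 2 := pow_le_pow_left₀ (by norm_num) hw 2
    rw [mul_pow]
    linarith
  · rw [hq, Real.log_pow, Real.log_mul hx0.ne' hSpos.ne', ← hgeom, Real.log_mul hSpos.ne' hb.ne']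
    push_cast
    ring

/-- The three logarithms of `kernel_bounds` are approximated separately. The offsets ln(1/γ) and 1
make the two trigonometric series nonnegative, and the ranges 2 ln(1/γ), 2 and 32/2 add up. The
errors are e^{-l}, e^{-l} and 272e^{-l}/2. -/
theorem exists_coin_neg_log {γ : ℝ} (h0 : 0 < γ) (h1 : γ ≤ 1 / 2) (l : ℕ) (hl : 1 ≤ l) :
    ∃ (d : ℕ) (g : ℂ → ℝ), (d : ℝ) ≤ 1024 * l / γ ∧
      Coin d (2 * Real.log (1 / γ) + 18) g ∧
      ∀ z : ℂ, ‖z‖ = 1 → γ ≤ z.re → z.re ≤ 1 →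
        |g z - Real.log (1 / γ) - 1 + Real.log z.re| ≤ 138 * Real.exp (-(l : ℝ)) := by
  set n := ⌈1 / γ⌉₊ with hn
  have hn1 : 1 / γ ≤ n := Nat.le_ceil _
  have hn2 : (n : ℝ) + 1 ≤ 2 / γ := by
    have h2 : (n : ℝ) < 1 / γ + 1 := Nat.ceil_lt_add_one (by positivity)
    have h3 : 2 ≤ 1 / γ := by rw [le_div_iff₀ h0]; linarith
    have h4 : 2 / γ = 1 / γ + 1 / γ := by ring
    linarith
  set r := 1 - γ with hr
  have hr0 : 0 ≤ r := by linarith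
  have hr1 : r < 1 := by linarith
  have hl' : (1 : ℝ) ≤ l := by exact_mod_cast hl
  -- With this cutoff r^K = ρ^l ≤ e^{-l}.
  set K := l * (n + 1) with hK
  set ρ := r ^ (n + 1) with hρ
  have hρ0 : 0 ≤ ρ := by positivity
  have hlog : Real.log (1 / γ) = -Real.log (1 - r) := by
    rw [hr, sub_sub_cancel, one_div, Real.log_inv]
  have hpow : ρ ≤ Real.exp (-1) := (kernel_bounds h0 h1 n hn1 (z := 1) (by simp)
    (by simp; linarith)).1
  have hexp : Real.exp (-1) ≤ 1 / 2 := by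
    rw [Real.exp_neg, inv_le_comm₀ (Real.exp_pos 1) (by norm_num)]
    linarith [Real.exp_one_gt_d9]
  have hρ2 : ρ ≤ 1 / 2 := hpow.trans hexp
  set D := 512 * l * (n + 1) with hD
  have hc1 : Coin D (2 * Real.log (1 / γ)) (fun z => Real.log (1 / γ) +
      ∑ k ∈ Finset.range K, r ^ (k + 1) / ((k : ℝ) + 1) *
        (((-X ^ 2 : ℂ[X]) ^ (k + 1)).eval z).re) := by
    refine coin_sum_re (fun k => by positivity) ?_ (fun k hk => ?_) fun k z hz => ?_
    · rw [hlog]; exact sum_pow_div_le hr0 hr1 K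
    · refine (natDegree_pow_le_of_le (k + 1) natDegree_neg_X_sq).trans ?_
      have : k + 1 ≤ l * (n + 1) := hk
      nlinarith
    · rw [eval_pow, norm_pow, norm_eval_neg_X_sq hz, one_pow]
  have hc2 : Coin D (2 * 1) (fun z => 1 +
      ∑ k ∈ Finset.range l, ρ ^ (k + 1) / ((k : ℝ) + 1) *
        ((-((-X ^ 2 : ℂ[X]) ^ (n + 1)) ^ (k + 1)).eval z).re) := by
    refine coin_sum_re (fun k => by positivity) ?_ (fun k hk => ?_) fun k z hz => ?_
    · refine (sum_pow_div_le hρ0 (by linarith) l).trans ?_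
      have : -Real.log (1 - ρ) ≤ -Real.log (1 / 2) :=
        neg_le_neg (Real.log_le_log (by norm_num) (by linarith))
      rw [one_div, Real.log_inv, neg_neg] at this
      linarith [Real.log_two_lt_d9]
    · rw [natDegree_neg]
      refine (natDegree_pow_le_of_le (k + 1)
        (natDegree_pow_le_of_le (n + 1) natDegree_neg_X_sq)).trans ?_
      have : (k + 1) * (n + 1) ≤ l * (n + 1) := Nat.mul_le_mul_right _ hk
      nlinarith
    · rw [eval_neg, norm_neg, eval_pow, eval_pow, norm_pow, norm_pow, norm_eval_neg_X_sq hz,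
        one_pow, one_pow]
  have hc3 : Coin D (1 / 2 * 32) (fun z => 1 / 2 *
      coinExp (kernelBias r n z) (256 * l) (logEstimator (256 * l) (8 * l))) := by
    refine Coin.const_mul (by norm_num) ?_
    have := coin_coinExp (coin_kernelBias hr0 hr1.le n) (256 * l) (B := 32)
      (logEstimator (256 * l) (8 * l)) (fun j hj => ?_)
    · refine this.mono ?_
      rw [hD]; nlinarith
    · unfold logEstimator
      split_ifs with hj'
      · refine ⟨harm_sub_nonneg hj, (harm_sub_le (by omega) hj' hj).trans ?_⟩
        rw [div_le_iff₀ (by push_cast; linarith)]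
        push_cast
        linarith
      · norm_num
  have hc := (hc1.add hc2).add hc3
  rw [show 2 * Real.log (1 / γ) + 2 * 1 + 1 / 2 * 32 = 2 * Real.log (1 / γ) + 18 by ring] at hc
  refine ⟨D, _, ?_, hc, ?_⟩
  · rw [hD]
    push_cast
    have : (512 * l * (n + 1) : ℝ) ≤ 512 * l * (2 / γ) := by gcongr
    refine this.trans_eq ?_
    ring
  · intro z hz hx hx1
    obtain ⟨-, hq, hlogz⟩ := kernel_bounds h0 h1 n hn1 hz hx
    have hq1 : kernelBias r n z ≤ 1 := by
      obtain ⟨ι, _, Q, _, h⟩ := (coin_kernelBias hr0 hr1.le n).2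
      have h3 := h z hz
      have h4 : 0 ≤ ∑ i, ‖(Q i).eval z‖ ^ 2 := Finset.sum_nonneg fun i _ => by positivity
      linarith
    have hru : ‖(r : ℂ) * -z ^ 2‖ = r := by
      rw [norm_mul, norm_neg, norm_pow, hz, one_pow, mul_one, Complex.norm_real, Real.norm_eq_abs,
        abs_of_nonneg hr0]
    have hrw : ‖((r : ℂ) * -z ^ 2) ^ (n + 1)‖ = ρ := by rw [norm_pow, hru]
    have a1 := abs_sum_re_add_log_norm_le (u := (r : ℂ) * -z ^ 2) (by rw [hru]; exact hr1) K
    have a2 := abs_sum_re_add_log_norm_le (u := ((r : ℂ) * -z ^ 2) ^ (n + 1))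
      (by rw [hrw]; linarith) l
    rw [hru] at a1
    rw [hrw] at a2
    have a3 := abs_coinExp_logEstimator_add_log hq hq1 l hl
    have hE := Real.exp_pos (-(l : ℝ))
    have b1 : r ^ (K + 1) * (1 - r)⁻¹ / (K + 1) ≤ Real.exp (-(l : ℝ)) := by
      -- The Taylor remainder has a factor 1/(1 - r) = 1/γ, which the denominator K + 1 absorbs.
      have hg : γ * (K + 1) ≥ 1 := by
        have h5 : (n : ℝ) ≤ K := by
          rw [hK]; exact_mod_cast (by nlinarith : n ≤ l * (n + 1))
        have h6 : 1 ≤ γ * n := by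
          rw [div_le_iff₀ h0] at hn1; linarith
        nlinarith
      have h7 : r ^ (K + 1) ≤ Real.exp (-(l : ℝ)) := by
        calc r ^ (K + 1) ≤ r ^ K := pow_le_pow_of_le_one hr0 hr1.le (by omega)
          _ = ρ ^ l := by rw [hK, hρ, ← pow_mul, mul_comm l]
          _ ≤ Real.exp (-1) ^ l := pow_le_pow_left₀ hρ0 hpow l
          _ = Real.exp (-(l : ℝ)) := by rw [← Real.exp_nat_mul]; congr 1; ring
      rw [show 1 - r = γ by rw [hr, sub_sub_cancel], div_eq_mul_inv, mul_assoc, ← mul_inv]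
      calc r ^ (K + 1) * (γ * (K + 1))⁻¹ ≤ Real.exp (-(l : ℝ)) * 1 :=
            mul_le_mul h7 (inv_le_one_of_one_le₀ hg) (by positivity) hE.le
        _ = _ := mul_one _
    have b2 : ρ ^ (l + 1) * (1 - ρ)⁻¹ / (l + 1) ≤ Real.exp (-(l : ℝ)) := by
      have h7 : ρ ^ l ≤ Real.exp (-(l : ℝ)) := by
        calc ρ ^ l ≤ Real.exp (-1) ^ l := pow_le_pow_left₀ hρ0 hpow l
          _ = Real.exp (-(l : ℝ)) := by rw [← Real.exp_nat_mul]; congr 1; ring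
      have h8 : ρ * (1 - ρ)⁻¹ ≤ 1 := by
        rw [← div_eq_mul_inv, div_le_one (by linarith)]; linarith
      have h9 : 0 ≤ ρ * (1 - ρ)⁻¹ := mul_nonneg hρ0 (inv_nonneg.mpr (by linarith))
      rw [div_le_iff₀ (by linarith), pow_succ, mul_assoc]
      have h10 : 0 ≤ ρ ^ l := by positivity
      nlinarith
    have e1 : ∑ k ∈ Finset.range K, r ^ (k + 1) / ((k : ℝ) + 1) *
        (((-X ^ 2 : ℂ[X]) ^ (k + 1)).eval z).re =
        ∑ k ∈ Finset.range K, (((r : ℂ) * -z ^ 2) ^ (k + 1)).re / ((k : ℝ) + 1) := by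
      refine Finset.sum_congr rfl fun k _ => ?_
      rw [mul_pow, ← Complex.ofReal_pow, Complex.re_ofReal_mul]
      simp only [eval_pow, eval_neg, eval_X]
      ring
    have e2 : ∑ k ∈ Finset.range l, ρ ^ (k + 1) / ((k : ℝ) + 1) *
        ((-((-X ^ 2 : ℂ[X]) ^ (n + 1)) ^ (k + 1)).eval z).re =
        -∑ k ∈ Finset.range l, ((((r : ℂ) * -z ^ 2) ^ (n + 1)) ^ (k + 1)).re / ((k : ℝ) + 1) := by
      rw [← Finset.sum_neg_distrib]
      refine Finset.sum_congr rfl fun k _ => ?_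
      rw [mul_pow, mul_pow, ← Complex.ofReal_pow, ← Complex.ofReal_pow, Complex.re_ofReal_mul]
      simp only [eval_pow, eval_neg, eval_X, Complex.neg_re]
      ring
    rw [e1, e2]
    replace a1 := a1.trans b1
    replace a2 := a2.trans b2
    rw [abs_le] at *
    constructor <;> linarith
end QEntropy

namespace QEntropy

/-! ### Chebyshev's inequality and repeated runs -/

section Statistics

theorem coinExp_sq_sub (q : ℝ) (M : ℕ) : ∀ b : ℝ, coinExp q M (fun j => ((j : ℝ) - b) ^ 2) =
    M * q * (1 - q) + (M * q - b) ^ 2 := by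
  induction M with
  | zero => intro b; simp [coinExp]
  | succ M ih =>
    intro b
    have : (fun j : ℕ => (((j + 1 : ℕ) : ℝ) - b) ^ 2) = fun j : ℕ => ((j : ℝ) - (b - 1)) ^ 2 := by
      ext j; push_cast; ring
    rw [coinExp, this, ih, ih]
    push_cast
    ring

/-- Chebyshev's inequality for the number of heads in `M` coin tosses. -/
theorem le_coinExp_of_concentrated {q : ℝ} (h0 : 0 ≤ q) (h1 : q ≤ 1) {M : ℕ} (hM : 0 < M) {t η : ℝ}
    (ht : 0 < t) (hη : 0 ≤ η) {f : ℕ → ℝ} (hf0 : ∀ j, 0 ≤ f j)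
    (hf : ∀ j : ℕ, |(j : ℝ) - M * q| < M * t → 1 - η ≤ f j) :
    1 - η - 1 / (M * t ^ 2) ≤ coinExp q M f := by
  have hM' : (0 : ℝ) < M := by exact_mod_cast hM
  have hMt : 0 < M * t := mul_pos hM' ht
  -- The function `f` is bounded below by the parabola 1 - η - ((j - Mq)/(Mt))², whose expectation
  -- involves only the variance.
  have h2 : coinExp q M (fun j => (1 - η) - 1 / (M * t) ^ 2 * ((j : ℝ) - M * q) ^ 2) ≤
      coinExp q M f := by
    refine coinExp_mono h0 h1 M _ _ fun j _ => ?_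
    by_cases hj : |(j : ℝ) - M * q| < M * t
    · have : 0 ≤ 1 / (M * t) ^ 2 * ((j : ℝ) - M * q) ^ 2 := by positivity
      linarith [hf j hj]
    · have h3 : (M * t) ^ 2 ≤ ((j : ℝ) - M * q) ^ 2 := by
        rw [← sq_abs ((j : ℝ) - M * q)]
        exact pow_le_pow_left₀ hMt.le (not_lt.mp hj) 2
      have h4 : 1 ≤ 1 / (M * t) ^ 2 * ((j : ℝ) - M * q) ^ 2 := by
        rw [one_div, ← div_eq_inv_mul, one_le_div (by positivity)]
        exact h3
      linarith [hf0 j]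
  refine le_trans ?_ h2
  rw [coinExp_sub, coinExp_const, coinExp_const_mul, coinExp_sq_sub, sub_self]
  have h5 : q * (1 - q) ≤ 1 := by nlinarith
  have h6 : 1 / (M * t) ^ 2 * (M * q * (1 - q) + 0 ^ 2) = q * (1 - q) * (1 / (M * t ^ 2)) := by
    field_simp
    ring
  rw [h6]
  have : 0 ≤ 1 / (M * t ^ 2) := by positivity
  nlinarith

theorem sum_prod_eq_coinExp {P : Fin 2 → ℝ} (hP : P 0 = 1 - P 1) (M : ℕ) : ∀ H : ℕ → ℝ,
    ∑ b : Fin M → Fin 2, H (∑ i, (b i : ℕ)) * ∏ i, P (b i) = coinExp (P 1) M H := by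
  induction M with
  | zero => intro H; simp [coinExp]
  | succ M ih =>
    intro H
    rw [← (Fin.consEquiv (fun _ => Fin 2)).sum_comp, Fintype.sum_prod_type, Fin.sum_univ_two]
    simp only [Fin.consEquiv_apply, Fin.sum_univ_succ, Fin.prod_univ_succ, Fin.cons_zero,
      Fin.cons_succ]
    rw [coinExp, ← ih, ← ih, hP, Finset.mul_sum, Finset.mul_sum, add_comm]
    congr 1
    · refine Finset.sum_congr rfl fun b _ => ?_
      rw [Fin.val_one, add_comm 1]
      ring
    · refine Finset.sum_congr rfl fun b _ => ?_
      rw [Fin.val_zero, zero_add]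
      ring

end Statistics

variable {n m : ℕ}

namespace AdaptiveAlgorithm

/-- Run the circuit `c` repeatedly and continue depending on the number of outcomes `1`. -/
def runMany (c : QueryCircuit n m) : ℕ → (ℕ → AdaptiveAlgorithm n m) → AdaptiveAlgorithm n m
  | 0, f => f 0
  | M + 1, f => run c fun b => runMany c M fun j => f (j + b)

theorem queries_runMany_le (c : QueryCircuit n m) {B : ℝ} (M : ℕ) :
    ∀ f : ℕ → AdaptiveAlgorithm n m, (∀ j, ((f j).queries : ℝ) ≤ B) →
      ((runMany c M f).queries : ℝ) ≤ M * c.queries + B := by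
  induction M with
  | zero => intro f hf; simpa [runMany] using hf 0
  | succ M ih =>
    intro f hf
    simp only [runMany, queries]
    push_cast
    have h1 := ih (fun j => f (j + ((0 : Fin 2) : ℕ))) fun j => hf _
    have h2 := ih (fun j => f (j + ((1 : Fin 2) : ℕ))) fun j => hf _
    have := max_le h1 h2
    linarith

theorem outputProb_runMany (c : QueryCircuit n m) (U : Unitaries (Sys n m)) (s : Set ℝ)
    (hc : c.outcomeProb U 0 = 1 - c.outcomeProb U 1) (M : ℕ) :
    ∀ f : ℕ → AdaptiveAlgorithm n m, outputProb U s (runMany c M f) =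
      coinExp (c.outcomeProb U 1) M (fun j => outputProb U s (f j)) := by
  induction M with
  | zero => intro f; rfl
  | succ M ih =>
    intro f
    simp only [runMany, outputProb, Fin.sum_univ_two, ih, coinExp, hc, Fin.val_zero, Fin.val_one,
      add_zero]
    ring

theorem outputProb_nonneg (U : Unitaries (Sys n m)) (s : Set ℝ) (A : AdaptiveAlgorithm n m) :
    0 ≤ outputProb U s A := by
  induction A with
  | output r => simp only [outputProb]; split_ifs <;> norm_num
  | run c next ih =>
    exact Finset.sum_nonneg fun b _ => mul_nonneg (c.outcomeProb_nonneg U b) (ih b)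

end AdaptiveAlgorithm

/-! ### Amplifying the deviation from a midpoint -/

section Centering

theorem coinProb_affine {ι : Type} [Fintype ι] [DecidableEq ι] {ρ : Matrix ι ι ℂ}
    (h : ρ.IsHermitian) (hsum : ∑ i, h.eigenvalues i = 1) (g : ℂ → ℝ) (a b : ℝ) :
    coinProb h (fun z => a * g z + b) = a * coinProb h g + b := by
  calc coinProb h (fun z => a * g z + b)
      = a * coinProb h g + b * ∑ i, h.eigenvalues i := by
        rw [coinProb, coinProb, Finset.mul_sum, Finset.mul_sum, ← Finset.sum_add_distrib]
        exact Finset.sum_congr rfl fun i _ => by ring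
    _ = _ := by rw [hsum, mul_one]

/-- Around angle π/4 an odd multiple stays centred at an odd multiple of π/4, so the probability
stays 1/2 plus a signed sine of the amplified deviation. -/
theorem sin_sq_centered (u : ℝ) (k : ℕ) :
    Real.sin ((2 * k + 1) * (Real.pi / 4 + Real.arcsin u / 2)) ^ 2 =
      1 / 2 + (-1) ^ k * Real.sin ((2 * k + 1) * Real.arcsin u) / 2 := by
  have e : 2 * ((2 * k + 1) * (Real.pi / 4 + Real.arcsin u / 2)) =
      ((2 * k + 1) * Real.arcsin u + Real.pi / 2) + k * Real.pi := by ring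
  have h := Real.cos_sq' ((2 * k + 1) * (Real.pi / 4 + Real.arcsin u / 2))
  have h2 := Real.cos_two_mul ((2 * k + 1) * (Real.pi / 4 + Real.arcsin u / 2))
  rw [e, Real.cos_add_nat_mul_pi, Real.cos_add_pi_div_two] at h2
  linarith

/-- A circuit whose outcome probability amplifies the deviation of the bias from `c`. -/
theorem exists_centered_circuit {d : ℕ} {g : ℂ → ℝ} (hg : Coin d 1 g) {c : ℝ} (hc0 : 0 ≤ c)
    (hc1 : c ≤ 1) (k : ℕ) :
    ∃ C : QueryCircuit n m, C.queries = (2 * k + 1) * (2 * d + 1) ∧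
      ∀ (U : Unitaries (Sys n m)) (h : (oracleState U).IsHermitian),
        (∀ i, 0 ≤ h.eigenvalues i) → (∀ i, h.eigenvalues i ≤ 1) → ∑ i, h.eigenvalues i = 1 →
        |coinProb h g - c| ≤ 1 →
          C.outcomeProb U 1 = 1 / 2 +
            (-1) ^ k * Real.sin ((2 * k + 1) * Real.arcsin (coinProb h g - c)) / 2 ∧
          C.outcomeProb U 0 = 1 - C.outcomeProb U 1 := by
  -- Mixing with a constant coin moves the bias p to 1/2 + (p - c)/2, hence the angle to π/4 when p
  -- = c.
  have hg' : Coin d 1 (fun z => 1 / 2 * g z + 1 / 2 * (1 - c)) := by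
    have := (hg.const_mul (c := 1 / 2) (by norm_num)).add
      (coin_const (d := d) (B := 1 / 2) (c := 1 / 2 * (1 - c)) (by linarith) (by linarith))
    rwa [show (1 / 2 * 1 + 1 / 2 : ℝ) = 1 by norm_num] at this
  obtain ⟨C, hC, hC'⟩ := exists_amplified_circuit (n := n) (m := m) hg'.1 hg'.2 k
  refine ⟨C, hC, fun U h h0 h1 hsum hu => ?_⟩
  obtain ⟨hu0, hu1⟩ := abs_le.mp hu
  have hφ : Real.sin (Real.pi / 4 + Real.arcsin (coinProb h g - c) / 2) ^ 2 =
      coinProb h (fun z => 1 / 2 * g z + 1 / 2 * (1 - c)) := by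
    have := sin_sq_centered (coinProb h g - c) 0
    simp only [Nat.cast_zero, mul_zero, zero_add, one_mul, pow_zero,
      Real.sin_arcsin hu0 hu1] at this
    rw [this, coinProb_affine h hsum]
    ring
  obtain ⟨e1, e0⟩ := hC' U h h0 h1 _ hφ
  rw [e0, e1, sin_sq_centered _ k]
  exact ⟨rfl, rfl⟩

/-- Jordan's inequality sin y ≥ 2y/π is used twice: it keeps the amplified angle below π/2, then
bounds its sine below by (3/5)·(1/9). -/
theorem le_sin_mul_arcsin {N w u : ℝ} (hN : 0 ≤ N) (hN1 : N * w ≤ 1) (hN2 : 1 / 3 ≤ N * w)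
    (hw : w ≤ 1) (hu : w / 3 ≤ u) (huw : u ≤ w) : 1 / 15 ≤ Real.sin (N * Real.arcsin u) := by
  have hπ := Real.pi_pos
  have hw0 : 0 ≤ w := by
    by_contra h
    nlinarith
  have hu0 : 0 ≤ u := by linarith
  have hy0 : 0 ≤ Real.arcsin u := Real.arcsin_nonneg.mpr hu0
  have hs : Real.sin (Real.arcsin u) = u := Real.sin_arcsin (by linarith) (by linarith)
  have hy1 : u ≤ Real.arcsin u := by
    have := Real.sin_le hy0
    rwa [hs] at this
  have hy2 : 2 / Real.pi * Real.arcsin u ≤ u := by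
    have := Real.mul_le_sin hy0 (Real.arcsin_le_pi_div_two u)
    rwa [hs] at this
  have hy3 : Real.arcsin u ≤ Real.pi / 2 * w := by
    have : Real.arcsin u = Real.pi / 2 * (2 / Real.pi * Real.arcsin u) := by field_simp
    rw [this]
    exact mul_le_mul_of_nonneg_left (hy2.trans huw) (by positivity)
  have hNy : N * Real.arcsin u ≤ Real.pi / 2 := by
    calc N * Real.arcsin u ≤ N * (Real.pi / 2 * w) := mul_le_mul_of_nonneg_left hy3 hN
      _ = Real.pi / 2 * (N * w) := by ring
      _ ≤ Real.pi / 2 * 1 := mul_le_mul_of_nonneg_left hN1 (by positivity)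
      _ = _ := mul_one _
  have h1 := Real.mul_le_sin (mul_nonneg hN hy0) hNy
  refine le_trans ?_ h1
  have h2 : 1 / 9 ≤ N * Real.arcsin u := by
    calc (1 / 9 : ℝ) ≤ N * (w / 3) := by linarith
      _ ≤ N * Real.arcsin u := mul_le_mul_of_nonneg_left (hu.trans hy1) hN
  have h3 : (3 / 5 : ℝ) ≤ 2 / Real.pi := by
    rw [le_div_iff₀ hπ]
    linarith [Real.pi_lt_d2]
  calc (1 / 15 : ℝ) = 3 / 5 * (1 / 9) := by norm_num
    _ ≤ 2 / Real.pi * (N * Real.arcsin u) := mul_le_mul h3 h2 (by norm_num) (by positivity)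

/-- The largest odd integer not exceeding 1/w is greater than 1/w - 2, which suffices for w ≤ 1/3;
for larger w already w itself exceeds 1/3. -/
theorem exists_odd_multiple {w : ℝ} (h0 : 0 < w) (h1 : w ≤ 1 / 2) :
    ∃ k : ℕ, (2 * (k : ℝ) + 1) * w ≤ 1 ∧ 1 / 3 ≤ (2 * (k : ℝ) + 1) * w := by
  have hw : 2 ≤ 1 / w := by rw [le_div_iff₀ h0]; linarith
  refine ⟨⌊(1 / w - 1) / 2⌋₊, ?_, ?_⟩
  · have := Nat.floor_le (show 0 ≤ (1 / w - 1) / 2 by linarith)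
    calc (2 * ((⌊(1 / w - 1) / 2⌋₊ : ℕ) : ℝ) + 1) * w ≤ (1 / w) * w :=
          mul_le_mul_of_nonneg_right (by linarith) h0.le
      _ = 1 := by field_simp
  · have := Nat.lt_floor_add_one ((1 / w - 1) / 2)
    have h3 : (1 / w - 2) * w ≤ (2 * ((⌊(1 / w - 1) / 2⌋₊ : ℕ) : ℝ) + 1) * w :=
      mul_le_mul_of_nonneg_right (by linarith) h0.le
    have h4 : (1 / w - 2) * w = 1 - 2 * w := by field_simp
    have h5 : (0 : ℝ) ≤ (⌊(1 / w - 1) / 2⌋₊ : ℕ) := Nat.cast_nonneg _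
    by_cases hc : w ≤ 1 / 3
    · linarith
    · nlinarith

end Centering

/-- Adaptive search: each stage shrinks the interval of candidates for the bias to two thirds. -/
theorem exists_adaptive_search {d : ℕ} {g : ℂ → ℝ} (hg : Coin d 1 g) {K : ℝ} (hK : 1 ≤ K)
    (out : ℝ → ℝ) (s : ℕ) : ∀ c w : ℝ, 0 < w → w ≤ 1 / 2 → 0 ≤ c - w → c + w ≤ 1 →
    ∃ A : AdaptiveAlgorithm n m,
      (A.queries : ℝ) ≤ 2 * K * (2 * d + 1) / w * (4 * ((3 / 2) ^ s - (5 / 4) ^ s)) ∧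
      ∀ (U : Unitaries (Sys n m)) (h : (oracleState U).IsHermitian),
        (∀ i, 0 ≤ h.eigenvalues i) → (∀ i, h.eigenvalues i ≤ 1) → ∑ i, h.eigenvalues i = 1 →
        |coinProb h g - c| ≤ w → ∀ S : Set ℝ,
          (∀ c', |coinProb h g - c'| ≤ w * (2 / 3) ^ s → out c' ∈ S) →
          1 - 900 / K * (5 * (1 - (4 / 5) ^ s)) ≤ A.outputProb U S := by
  induction s with
  | zero =>
    intro c w _ _ _ _
    refine ⟨.output (out c), by simp [AdaptiveAlgorithm.queries], fun U h _ _ _ hc S hS => ?_⟩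
    simp [AdaptiveAlgorithm.outputProb, hS c (by simpa using hc)]
  | succ s ih =>
    intro c w hw hw2 hc0 hc1
    obtain ⟨k, hk1, hk2⟩ := exists_odd_multiple hw hw2
    obtain ⟨C, hC, hC'⟩ := exists_centered_circuit (n := n) (m := m) hg (c := c) (by linarith)
      (by linarith) k
    -- The two subintervals of half-width 2w/3 overlap in |p - c| ≤ w/3, so a wrong decision matters
    -- only outside this overlap.
    obtain ⟨Ap, hAp, hAp'⟩ := ih (c + w / 3) (2 * w / 3) (by linarith) (by linarith) (by linarith)
      (by linarith)
    obtain ⟨Am, hAm, hAm'⟩ := ih (c - w / 3) (2 * w / 3) (by linarith) (by linarith) (by linarith)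
      (by linarith)
    -- Early stages have short circuits and receive more shots. The cost per stage still grows
    -- towards the end, by (3/2)/(5/4) at each stage, so the last stages dominate the total; the
    -- failure bounds sum as powers of 4/5.
    set M := ⌈K * (5 / 4) ^ s⌉₊ with hM
    have h54 : (1 : ℝ) ≤ (5 / 4) ^ s := one_le_pow₀ (by norm_num)
    have hKs : 1 ≤ K * (5 / 4) ^ s := by nlinarith
    have hM1 : K * (5 / 4) ^ s ≤ M := Nat.le_ceil _
    have hM2 : (M : ℝ) ≤ 2 * K * (5 / 4) ^ s := by
      have := Nat.ceil_lt_add_one (show 0 ≤ K * (5 / 4) ^ s by linarith)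
      linarith
    have hM0 : (0 : ℝ) < M := by linarith
    classical
    refine ⟨AdaptiveAlgorithm.runMany C M
      fun j => if 0 ≤ (-1) ^ k * ((j : ℝ) - M / 2) then Ap else Am, ?_, ?_⟩
    · refine (AdaptiveAlgorithm.queries_runMany_le C
        (B := 2 * K * (2 * d + 1) / (2 * w / 3) * (4 * ((3 / 2) ^ s - (5 / 4) ^ s))) M _
        fun j => ?_).trans ?_
      · split_ifs
        · exact hAp
        · exact hAm
      · have h2k : (2 * (k : ℝ) + 1) ≤ 1 / w := by rw [le_div_iff₀ hw]; exact hk1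
        have hq : (M : ℝ) * C.queries ≤ 2 * K * (5 / 4) ^ s * (1 / w * (2 * d + 1)) := by
          rw [hC]
          push_cast
          gcongr
        refine (add_le_add_left hq _).trans_eq ?_
        rw [pow_succ, pow_succ]
        field_simp
        ring
    · intro U h h0 h1 hsum hc S hS
      obtain ⟨e1, e0⟩ := hC' U h h0 h1 hsum (hc.trans (by linarith))
      rw [AdaptiveAlgorithm.outputProb_runMany C U S e0]
      have hp0 := C.outcomeProb_nonneg U 1
      have hp1 : C.outcomeProb U 1 ≤ 1 := by linarith [C.outcomeProb_nonneg U 0]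
      set p := coinProb h g with hp
      set η := 900 / K * (5 * (1 - (4 / 5) ^ s)) with hη
      have h45 : (4 / 5 : ℝ) ^ s ≤ 1 := pow_le_one₀ (by norm_num) (by norm_num)
      have hη0 : 0 ≤ η := by
        have : 0 ≤ 1 - (4 / 5 : ℝ) ^ s := by linarith
        positivity
      have hscale : 2 * w / 3 * (2 / 3) ^ s = w * (2 / 3) ^ (s + 1) := by rw [pow_succ]; ring
      have hplus : -(w / 3) ≤ p - c → 1 - η ≤ Ap.outputProb U S := by
        intro hle
        have := (abs_le.mp hc).2
        refine hAp' U h h0 h1 hsum (abs_le.mpr ⟨by linarith, by linarith⟩) S ?_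
        rw [hscale]; exact hS
      have hminus : p - c ≤ w / 3 → 1 - η ≤ Am.outputProb U S := by
        intro hle
        have := (abs_le.mp hc).1
        refine hAm' U h h0 h1 hsum (abs_le.mpr ⟨by linarith, by linarith⟩) S ?_
        rw [hscale]; exact hS
      have hsgn : ((-1 : ℝ) ^ k) * (-1) ^ k = 1 := by
        rw [← mul_pow]; norm_num
      -- Outside the overlap the sine is at least 1/15 in absolute value, so the outcome probability
      -- is at least 1/30 away from 1/2, the tolerance used here.
      have key : ∀ j : ℕ, |(j : ℝ) - M * C.outcomeProb U 1| < M * (1 / 30) →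
          1 - η ≤ AdaptiveAlgorithm.outputProb U S
            (if 0 ≤ (-1) ^ k * ((j : ℝ) - M / 2) then Ap else Am) := by
        intro j hj
        set σ : ℝ := (-1) ^ k with hσ
        have hσ1 : |σ| = 1 := by rw [hσ, abs_pow, abs_neg, abs_one, one_pow]
        set y := Real.sin ((2 * k + 1) * Real.arcsin (p - c)) with hy
        have hj2 : |σ * ((j : ℝ) - M / 2) - M * y / 2| < M * (1 / 30) := by
          have : σ * ((j : ℝ) - M / 2) - M * y / 2 = σ * ((j : ℝ) - M * C.outcomeProb U 1) := by
            rw [e1]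
            linear_combination (M * y / 2) * hsgn
          rw [this, abs_mul, hσ1, one_mul]
          exact hj
        obtain ⟨hj3, hj4⟩ := abs_lt.mp hj2
        have hN0 : (0 : ℝ) ≤ 2 * k + 1 := by positivity
        split_ifs with hdec
        · refine hplus (not_lt.mp fun hlt => ?_)
          have h5 := le_sin_mul_arcsin (u := -(p - c)) hN0 hk1 hk2 (by linarith) (by linarith)
            (by linarith [(abs_le.mp hc).1])
          rw [Real.arcsin_neg, mul_neg, Real.sin_neg, ← hy] at h5
          nlinarith
        · refine hminus (not_lt.mp fun hlt => ?_)
          have h5 := le_sin_mul_arcsin (u := p - c) hN0 hk1 hk2 (by linarith) hlt.le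
            (by linarith [(abs_le.mp hc).2])
          rw [← hy] at h5
          nlinarith
      have hmain := le_coinExp_of_concentrated hp0 hp1 (by exact_mod_cast hM0) (t := 1 / 30)
        (by norm_num) hη0 (fun j => AdaptiveAlgorithm.outputProb_nonneg U S _) key
      refine le_trans ?_ hmain
      have h900 : 1 / ((M : ℝ) * (1 / 30) ^ 2) ≤ 900 / K * (4 / 5) ^ s := by
        have e45 : (4 / 5 : ℝ) ^ s = 1 / (5 / 4) ^ s := by
          rw [← one_div_pow]; norm_num
        rw [e45, div_mul_div_comm, mul_one, div_le_div_iff₀ (by positivity) (by positivity)]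
        linarith
      have e5 : 1 - 900 / K * (5 * (1 - (4 / 5) ^ (s + 1))) = 1 - η - 900 / K * (4 / 5) ^ s := by
        rw [hη, pow_succ]; ring
      rw [e5]
      exact sub_le_sub_left h900 _

end QEntropy

namespace QEntropy

/-! ### Spectral bounds and the entropy -/

section Spectrum

variable {ι : Type} [Fintype ι] [DecidableEq ι] {ρ : Matrix ι ι ℂ}

theorem sum_eigenvalues_eq_one (hρ : IsDensityMatrix ρ) (h : ρ.IsHermitian) :
    ∑ i, h.eigenvalues i = 1 := by
  have h1 := trace_eq_sum h
  rw [hρ.2, ← Complex.ofReal_sum] at h1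
  exact_mod_cast h1.symm

theorem eigenvalues_le_one (hρ : IsDensityMatrix ρ) (h : ρ.IsHermitian) (i : ι) :
    h.eigenvalues i ≤ 1 := by
  rw [← sum_eigenvalues_eq_one hρ h]
  exact Finset.single_le_sum (fun j _ => hρ.1.eigenvalues_nonneg j) (Finset.mem_univ i)

theorem le_eigenvalues {γ : ℝ} (hγ : NonzeroEigenvaluesGE ρ γ) (h : ρ.IsHermitian) (i : ι)
    (hi : h.eigenvalues i ≠ 0) : γ ≤ h.eigenvalues i := by
  refine hγ _ hi (Module.End.hasEigenvalue_of_hasEigenvector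
    (x := ⇑(h.eigenvectorBasis i)) ⟨?_, ?_⟩)
  · rw [Module.End.mem_eigenspace_iff, Matrix.toLin'_apply, h.mulVec_eigenvectorBasis]
    ext j
    simp
  · intro h0
    refine h.eigenvectorBasis.orthonormal.ne_zero i ?_
    ext j
    exact congrFun h0 j

theorem eigenvalue_dichotomy {γ : ℝ} (hγ : NonzeroEigenvaluesGE ρ γ) (h : ρ.IsHermitian) (i : ι) :
    h.eigenvalues i = 0 ∨ γ ≤ h.eigenvalues i :=
  or_iff_not_imp_left.mpr (le_eigenvalues hγ h i)

theorem vonNeumannEntropy_nonneg (hρ : IsDensityMatrix ρ) : 0 ≤ vonNeumannEntropy ρ := by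
  have h := hρ.1.isHermitian
  rw [vonNeumannEntropy_eq_sum h, ← Finset.sum_neg_distrib]
  exact Finset.sum_nonneg fun i _ => neg_nonneg.mpr (mul_nonpos_of_nonneg_of_nonpos
    (hρ.1.eigenvalues_nonneg i)
    (Real.log_nonpos (hρ.1.eigenvalues_nonneg i) (eigenvalues_le_one hρ h i)))

theorem vonNeumannEntropy_le {γ : ℝ} (h0 : 0 < γ) (hρ : IsDensityMatrix ρ)
    (hγ : NonzeroEigenvaluesGE ρ γ) : vonNeumannEntropy ρ ≤ Real.log (1 / γ) := by
  have h := hρ.1.isHermitian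
  rw [vonNeumannEntropy_eq_sum h, ← Finset.sum_neg_distrib]
  calc ∑ i, -(h.eigenvalues i * Real.log (h.eigenvalues i))
      ≤ ∑ i, h.eigenvalues i * Real.log (1 / γ) := by
        refine Finset.sum_le_sum fun i _ => ?_
        rcases eigenvalue_dichotomy hγ h i with hi | hi
        · simp [hi]
        · rw [one_div, Real.log_inv, mul_neg]
          exact neg_le_neg (mul_le_mul_of_nonneg_left (Real.log_le_log h0 hi) (h0.le.trans hi))
    _ = Real.log (1 / γ) := by rw [← Finset.sum_mul, sum_eigenvalues_eq_one hρ h, one_mul]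

/-- Two eigenvalues above 1/2 would exceed the trace, so the state is pure. -/
theorem vonNeumannEntropy_eq_zero {γ : ℝ} (h0 : 1 / 2 < γ) (hρ : IsDensityMatrix ρ)
    (hγ : NonzeroEigenvaluesGE ρ γ) : vonNeumannEntropy ρ = 0 := by
  have h := hρ.1.isHermitian
  rw [vonNeumannEntropy_eq_sum h, neg_eq_zero]
  refine Finset.sum_eq_zero fun i _ => ?_
  rcases eigenvalue_dichotomy hγ h i with hi | hi
  · simp [hi]
  · have h1 : h.eigenvalues i = 1 := by
      rw [← sum_eigenvalues_eq_one hρ h]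
      refine (Finset.sum_eq_single i (fun j _ hj => ?_) (by simp)).symm
      refine (eigenvalue_dichotomy hγ h j).resolve_right fun hj' => ?_
      have h2 : h.eigenvalues i + h.eigenvalues j ≤ ∑ k, h.eigenvalues k := by
        rw [← Finset.sum_pair hj.symm]
        exact Finset.sum_le_sum_of_subset_of_nonneg (Finset.subset_univ _)
          fun k _ _ => hρ.1.eigenvalues_nonneg k
      rw [sum_eigenvalues_eq_one hρ h] at h2
      linarith
    rw [h1, Real.log_one, mul_zero]

/-- A coin approximating the logarithm on the spectrum estimates the entropy. -/
theorem abs_coinProb_sub_entropy_le {γ a τ : ℝ} (hρ : IsDensityMatrix ρ)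
    (hγ : NonzeroEigenvaluesGE ρ γ) {g : ℂ → ℝ} (h : ρ.IsHermitian)
    (hg : ∀ z : ℂ, ‖z‖ = 1 → γ ≤ z.re → z.re ≤ 1 → |g z - a + Real.log z.re| ≤ τ) :
    |coinProb h g - a - vonNeumannEntropy ρ| ≤ τ := by
  have hsum := sum_eigenvalues_eq_one hρ h
  have e : coinProb h g - a - vonNeumannEntropy ρ = ∑ i, h.eigenvalues i *
      ((g (circlePoint (h.eigenvalues i)) + g (star (circlePoint (h.eigenvalues i)))) / 2 - a +
        Real.log (h.eigenvalues i)) := by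
    have : a = ∑ i, h.eigenvalues i * a := by rw [← Finset.sum_mul, hsum, one_mul]
    rw [vonNeumannEntropy_eq_sum h, coinProb, sub_neg_eq_add]
    nth_rewrite 1 [this]
    rw [← Finset.sum_sub_distrib, ← Finset.sum_add_distrib]
    exact Finset.sum_congr rfl fun i _ => by ring
  rw [e]
  calc |∑ i, h.eigenvalues i *
      ((g (circlePoint (h.eigenvalues i)) + g (star (circlePoint (h.eigenvalues i)))) / 2 - a +
        Real.log (h.eigenvalues i))| ≤ ∑ i, h.eigenvalues i * τ := by
        refine (Finset.abs_sum_le_sum_abs _ _).trans (Finset.sum_le_sum fun i _ => ?_)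
        rw [abs_mul, abs_of_nonneg (hρ.1.eigenvalues_nonneg i)]
        -- A zero eigenvalue has zero weight, so `g` need not approximate the logarithm near 0.
        rcases eigenvalue_dichotomy hγ h i with hi | hi
        · simp [hi]
        · refine mul_le_mul_of_nonneg_left ?_ (hρ.1.eigenvalues_nonneg i)
          have h0 := hρ.1.eigenvalues_nonneg i
          have h1 := eigenvalues_le_one hρ h i
          have hre := re_circlePoint (p := h.eigenvalues i) (by linarith) h1
          have a1 := hg (circlePoint (h.eigenvalues i)) (norm_circlePoint _)
            (by rw [hre]; exact hi) (by rw [hre]; exact h1)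
          have hre' : (star (circlePoint (h.eigenvalues i))).re = h.eigenvalues i := by
            rw [Complex.star_def, Complex.conj_re, hre]
          have a2 := hg (star (circlePoint (h.eigenvalues i)))
            (by rw [norm_star, norm_circlePoint]) (by rw [hre']; exact hi)
            (by rw [hre']; exact h1)
          rw [hre] at a1
          rw [hre'] at a2
          rw [abs_le] at *
          constructor <;> linarith
    _ = τ := by rw [← Finset.sum_mul, hsum, one_mul]

theorem coinProb_mem_Icc (hρ : IsDensityMatrix ρ) (h : ρ.IsHermitian) {d : ℕ} {g : ℂ → ℝ}
    (hg : Coin d 1 g) : coinProb h g ∈ Set.Icc 0 1 := by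
  have hb : ∀ z : ℂ, ‖z‖ = 1 → 0 ≤ g z ∧ g z ≤ 1 := by
    intro z hz
    obtain ⟨ι, _, Q, _, hQ⟩ := hg.1
    obtain ⟨ι', _, Q', _, hQ'⟩ := hg.2
    have q1 := hQ z hz
    have q2 := hQ' z hz
    have q3 : 0 ≤ ∑ i, ‖(Q i).eval z‖ ^ 2 := Finset.sum_nonneg fun i _ => by positivity
    have q4 : 0 ≤ ∑ i, ‖(Q' i).eval z‖ ^ 2 := Finset.sum_nonneg fun i _ => by positivity
    constructor <;> linarith
  have hc := fun i => hb _ (norm_circlePoint (h.eigenvalues i))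
  have hs := fun i => hb (star (circlePoint (h.eigenvalues i)))
    (by rw [norm_star, norm_circlePoint])
  constructor
  · exact Finset.sum_nonneg fun i _ => mul_nonneg (hρ.1.eigenvalues_nonneg i) (by
      linarith [(hc i).1, (hs i).1])
  · rw [← sum_eigenvalues_eq_one hρ h]
    refine Finset.sum_le_sum fun i _ => mul_le_of_le_one_right (hρ.1.eigenvalues_nonneg i) ?_
    linarith [(hc i).2, (hs i).2]

end Spectrum

/-! ### From coins to entropy estimators -/

variable {n m : ℕ}

/-- The success guarantee of an entropy estimator with output probabilities `prob`. -/
def EstimatesEntropy (n m : ℕ) (γ ε δ : ℝ)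
    (prob : Unitaries (Sys n m) → Set ℝ → ℝ) : Prop :=
  ∀ (ρ : Matrix (Qubits n) (Qubits n) ℂ) (U : Unitaries (Qubits n × Qubits m)),
    IsDensityMatrix ρ → NonzeroEigenvaluesGE ρ γ → IsPurifiedQueryOracle U ρ →
    1 - δ ≤ prob U {E : ℝ | |E - vonNeumannEntropy ρ| ≤ ε}

theorem exists_sampling_of_const {γ ε δ : ℝ} (hδ : 0 ≤ δ) (r : ℝ)
    (hr : ∀ ρ : Matrix (Qubits n) (Qubits n) ℂ, IsDensityMatrix ρ → NonzeroEigenvaluesGE ρ γ →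
      |r - vonNeumannEntropy ρ| ≤ ε) :
    ∃ P : SamplingAlgorithm n m, P.queries = 0 ∧ EstimatesEntropy n m γ ε δ P.outputProb := by
  -- With zero shots the empty product makes the output certain.
  refine ⟨⟨⟨0, 1, []⟩, 0, fun _ => r⟩, by simp [SamplingAlgorithm.queries], ?_⟩
  intro ρ U hρ hγ _
  simp [SamplingAlgorithm.outputProb, hr ρ hρ hγ, hδ]

theorem exists_adaptive_of_const {γ ε δ : ℝ} (hδ : 0 ≤ δ) (r : ℝ)
    (hr : ∀ ρ : Matrix (Qubits n) (Qubits n) ℂ, IsDensityMatrix ρ → NonzeroEigenvaluesGE ρ γ →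
      |r - vonNeumannEntropy ρ| ≤ ε) :
    ∃ P : AdaptiveAlgorithm n m, P.queries = 0 ∧
      EstimatesEntropy n m γ ε δ (fun U s => P.outputProb U s) := by
  refine ⟨.output r, by simp [AdaptiveAlgorithm.queries], ?_⟩
  intro ρ U hρ hγ _
  simp [AdaptiveAlgorithm.outputProb, hr ρ hρ hγ, hδ]

/-- A coin whose bias determines the entropy up to `ε / 2`. -/
def IsEntropyCoin (n : ℕ) (γ ε Z a : ℝ) (g : ℂ → ℝ) : Prop :=
  ∀ (ρ : Matrix (Qubits n) (Qubits n) ℂ) (h : ρ.IsHermitian), IsDensityMatrix ρ →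
    NonzeroEigenvaluesGE ρ γ → |Z * coinProb h g - a - vonNeumannEntropy ρ| ≤ ε / 2

theorem exists_sampling_of_coin {γ ε δ Z a : ℝ} (hδ : 0 < δ) (hδ1 : δ < 1) (hε : 0 < ε)
    (hZ : ε ≤ Z) {d : ℕ} {g : ℂ → ℝ} (hg : Coin d 1 g) (hgS : IsEntropyCoin n γ ε Z a g) :
    ∃ P : SamplingAlgorithm n m, (P.queries : ℝ) ≤ 5 * Z ^ 2 / (δ * ε ^ 2) * (2 * d + 1) ∧
      EstimatesEntropy n m γ ε δ P.outputProb := by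
  have hZ0 : 0 < Z := hε.trans_le hZ
  -- Zero rounds of amplification: the outcome probability is the bias itself.
  obtain ⟨C, hC, hC'⟩ := exists_amplified_circuit (n := n) (m := m) hg.1 hg.2 0
  have hx : 1 ≤ Z ^ 2 / (δ * ε ^ 2) := by
    rw [one_le_div (by positivity)]
    have : ε ^ 2 ≤ Z ^ 2 := pow_le_pow_left₀ hε.le hZ 2
    nlinarith [sq_nonneg ε]
  -- Chebyshev with tolerance t = ε/(2Z) on the bias needs 1/(Mt²) ≤ δ.
  set M := ⌈4 * (Z ^ 2 / (δ * ε ^ 2))⌉₊ with hM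
  have hM1 : 4 * (Z ^ 2 / (δ * ε ^ 2)) ≤ M := Nat.le_ceil _
  have hM2 : (M : ℝ) ≤ 5 * Z ^ 2 / (δ * ε ^ 2) := by
    have := Nat.ceil_lt_add_one (show 0 ≤ 4 * (Z ^ 2 / (δ * ε ^ 2)) by linarith)
    have e : 5 * Z ^ 2 / (δ * ε ^ 2) = 5 * (Z ^ 2 / (δ * ε ^ 2)) := by ring
    rw [e]
    linarith
  have hM0 : (0 : ℝ) < M := by linarith
  refine ⟨⟨C, M, fun b => Z * ((∑ i, ((b i : ℕ)) : ℕ) / M : ℝ) - a⟩, ?_, ?_⟩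
  · simp only [SamplingAlgorithm.queries, hC]
    push_cast
    simp only [one_mul]
    exact mul_le_mul_of_nonneg_right hM2 (by positivity)
  · intro ρ U hρ hγ hU
    obtain rfl : oracleState U = ρ := hU
    have h := hρ.1.isHermitian
    have hg0 := fun i => hρ.1.eigenvalues_nonneg i
    have hg1 := eigenvalues_le_one hρ h
    have hp := hgS _ h hρ hγ
    set p := coinProb h g with hpdef
    have hpc : C.outcomeProb U 1 = p ∧ C.outcomeProb U 0 = 1 - p ∧ 0 ≤ p ∧ p ≤ 1 := by
      obtain ⟨hp0, hp1⟩ := coinProb_mem_Icc hρ h hg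
      have hs : Real.sin (Real.arcsin (√p)) ^ 2 = p := by
        rw [Real.sin_arcsin (by linarith [Real.sqrt_nonneg p])
          (Real.sqrt_le_one.mpr hp1), Real.sq_sqrt hp0]
      obtain ⟨e1, e0⟩ := hC' U h hg0 hg1 (Real.arcsin (√p)) hs
      simp only [Nat.cast_zero, mul_zero, zero_add, one_mul, hs] at e1 e0
      exact ⟨e1, e0, hp0, hp1⟩
    obtain ⟨e1, e0, hp0, hp1⟩ := hpc
    classical
    have hout : ∀ S : Set ℝ, SamplingAlgorithm.outputProb
        ⟨C, M, fun b => Z * ((∑ i, ((b i : ℕ)) : ℕ) / M : ℝ) - a⟩ U S =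
        coinExp p M (fun j => if Z * ((j : ℝ) / M) - a ∈ S then 1 else 0) := by
      intro S
      have := sum_prod_eq_coinExp (P := C.outcomeProb U) (by rw [e0, e1]) M
        (fun j => if Z * ((j : ℝ) / M) - a ∈ S then 1 else 0)
      rw [e1] at this
      rw [← this, SamplingAlgorithm.outputProb]
      refine Finset.sum_congr rfl fun b _ => ?_
      by_cases hb : Z * (((∑ i, ((b i : ℕ)) : ℕ) : ℝ) / M) - a ∈ S
      · rw [if_pos hb, if_pos hb, one_mul]
      · rw [if_neg hb, if_neg hb, zero_mul]
    rw [hout]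
    have ht : 0 < ε / (2 * Z) := by positivity
    have hmain := le_coinExp_of_concentrated hp0 hp1 (M := M) (by exact_mod_cast hM0)
      (t := ε / (2 * Z)) ht le_rfl (f := fun j => if Z * ((j : ℝ) / M) - a ∈
        {E : ℝ | |E - vonNeumannEntropy (oracleState U)| ≤ ε} then 1 else 0)
      (fun j => by split_ifs <;> norm_num) (fun j hj => by
        rw [if_pos, sub_zero]
        have hj2 : |Z * ((j : ℝ) / M) - Z * p| ≤ ε / 2 := by
          have e : Z * ((j : ℝ) / M) - Z * p = Z / M * ((j : ℝ) - M * p) := by field_simp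
          rw [e, abs_mul, abs_of_pos (by positivity)]
          calc Z / M * |(j : ℝ) - M * p| ≤ Z / M * (M * (ε / (2 * Z))) :=
                mul_le_mul_of_nonneg_left hj.le (by positivity)
            _ = ε / 2 := by field_simp
        show |_ - _| ≤ ε
        rw [abs_le] at *
        constructor <;> linarith)
    refine le_trans ?_ hmain
    have : 1 / ((M : ℝ) * (ε / (2 * Z)) ^ 2) ≤ δ := by
      rw [div_le_iff₀ (by positivity)]
      calc (1 : ℝ) = δ * (4 * (Z ^ 2 / (δ * ε ^ 2)) * (ε / (2 * Z)) ^ 2) := by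
            field_simp
            norm_num
        _ ≤ δ * (M * (ε / (2 * Z)) ^ 2) := by gcongr
    linarith

theorem exists_adaptive_of_coin {γ ε δ Z a : ℝ} (hδ : 0 < δ) (hδ1 : δ < 1) (hε : 0 < ε)
    (hZ : ε ≤ Z) {d : ℕ} {g : ℂ → ℝ} (hg : Coin d 1 g) (hgS : IsEntropyCoin n γ ε Z a g) :
    ∃ P : AdaptiveAlgorithm n m, (P.queries : ℝ) ≤ 108000 * Z / (δ * ε) * (2 * d + 1) ∧
      EstimatesEntropy n m γ ε δ (fun U s => P.outputProb U s) := by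
  have hZ0 : 0 < Z := hε.trans_le hZ
  have hx : 1 ≤ Z / ε := by rw [one_le_div hε]; exact hZ
  -- After s + 1 stages the initial half-width 1/2 has shrunk below ε/(2Z), while (3/2)^s ≤ Z/ε
  -- bounds the cost.
  obtain ⟨s, hs1, hs2⟩ := exists_nat_pow_near hx (show (1 : ℝ) < 3 / 2 by norm_num)
  -- The total failure is less than 900·5/K, which equals δ for this K.
  have hK : 1 ≤ 4500 / δ := by rw [one_le_div hδ]; linarith
  obtain ⟨A, hA, hA'⟩ := exists_adaptive_search (n := n) (m := m) hg hK (fun c => Z * c - a)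
    (s + 1) (1 / 2) (1 / 2) (by norm_num) le_rfl (by norm_num) (by norm_num)
  refine ⟨A, ?_, ?_⟩
  · refine hA.trans ?_
    have h1 : (3 / 2 : ℝ) ^ (s + 1) - (5 / 4) ^ (s + 1) ≤ 3 / 2 * (Z / ε) := by
      have : (0 : ℝ) ≤ (5 / 4) ^ (s + 1) := by positivity
      rw [pow_succ]
      linarith
    calc 2 * (4500 / δ) * (2 * d + 1) / (1 / 2) * (4 * ((3 / 2 : ℝ) ^ (s + 1) - (5 / 4) ^ (s + 1)))
        ≤ 2 * (4500 / δ) * (2 * d + 1) / (1 / 2) * (4 * (3 / 2 * (Z / ε))) := by gcongr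
      _ = 108000 * Z / (δ * ε) * (2 * d + 1) := by
          field_simp
          ring
  · intro ρ U hρ hγ hU
    obtain rfl : oracleState U = ρ := hU
    have h := hρ.1.isHermitian
    have hg0 := fun i => hρ.1.eigenvalues_nonneg i
    have hg1 := eigenvalues_le_one hρ h
    have hsum := sum_eigenvalues_eq_one hρ h
    have hp := hgS _ h hρ hγ
    obtain ⟨hp0, hp1⟩ := coinProb_mem_Icc hρ h hg
    refine le_trans ?_ (hA' U h hg0 hg1 hsum
      (abs_le.mpr ⟨by linarith, by linarith⟩) _ fun c' hc' => ?_)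
    · have h45 : (0 : ℝ) ≤ (4 / 5) ^ (s + 1) := by positivity
      have e : 900 / (4500 / δ) * (5 * (1 - (4 / 5) ^ (s + 1))) = δ * (1 - (4 / 5) ^ (s + 1)) := by
        field_simp
        ring
      rw [e]
      nlinarith
    · have hpow : (2 / 3 : ℝ) ^ (s + 1) ≤ ε / Z := by
        rw [show (2 / 3 : ℝ) = (3 / 2)⁻¹ by norm_num, inv_pow, ← inv_div Z ε]
        exact inv_anti₀ (by positivity) hs2.le
      have hc : |Z * coinProb h g - Z * c'| ≤ ε / 2 := by
        rw [← mul_sub, abs_mul, abs_of_pos hZ0]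
        calc Z * |coinProb h g - c'| ≤ Z * (1 / 2 * (ε / Z)) :=
              mul_le_mul_of_nonneg_left (hc'.trans (by gcongr)) hZ0.le
          _ = ε / 2 := by field_simp
      show |_ - _| ≤ ε
      rw [abs_le] at *
      constructor <;> linarith

end QEntropy

/-! ### Choice of parameters -/

namespace QEntropy

variable {n : ℕ}

/-- A bounded coin that determines the entropy to precision `ε / 2`. -/
theorem exists_entropyCoin {γ ε : ℝ} (h0 : 0 < γ) (h1 : γ ≤ 1 / 2) (hε : 0 < ε)
    (hε' : 2 * ε < Real.log (1 / γ)) :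
    ∃ (d : ℕ) (g : ℂ → ℝ) (Z a : ℝ), ε ≤ Z ∧ Z ≤ 38 * Real.log (1 / γ) ∧
      (2 * d + 1 : ℝ) ≤ 30000 * Real.log (Real.log (1 / γ) / ε) / γ ∧ Coin d 1 g ∧
      IsEntropyCoin n γ ε Z a g := by
  set Λ := Real.log (1 / γ) with hΛ
  have hl2 : (1 : ℝ) / 2 < Real.log 2 := by linarith [Real.log_two_gt_d9]
  have hΛ2 : 1 / 2 < Λ := hl2.trans_le (Real.log_le_log two_pos (by
    rw [le_div_iff₀ h0]
    linarith))
  have hq : 2 < Λ / ε := by rw [lt_div_iff₀ hε]; exact hε'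
  set L := Real.log (Λ / ε) with hL
  have hL2 : 1 / 2 < L := hl2.trans_le (Real.log_le_log two_pos hq.le)
  -- Then e^{-l} ≤ (ε/Λ)^11. Ten factors give 2^{-10} and the last is at most 2ε, so 138e^{-l} ≤
  -- ε/2.
  have hl1 : 11 * L ≤ ⌈11 * L⌉₊ := Nat.le_ceil _
  have hl3 : (⌈11 * L⌉₊ : ℝ) ≤ 13 * L := by
    have := Nat.ceil_lt_add_one (show 0 ≤ 11 * L by linarith)
    linarith
  set l := ⌈11 * L⌉₊
  have hl : 1 ≤ l := by
    have : (1 : ℝ) ≤ l := by linarith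
    exact_mod_cast this
  have hexp : 138 * Real.exp (-(l : ℝ)) ≤ ε / 2 := by
    have e1 : Real.exp (-(l : ℝ)) ≤ (ε / Λ) ^ 11 := by
      calc Real.exp (-(l : ℝ)) ≤ Real.exp (-((11 : ℕ) * L)) :=
            Real.exp_le_exp.mpr (by push_cast; linarith)
        _ = (ε / Λ) ^ 11 := by
            rw [Real.exp_neg, Real.exp_nat_mul, hL, Real.exp_log (by linarith), ← inv_pow, inv_div]
    have hr : 0 < ε / Λ := div_pos hε (by linarith)
    have hr2 : ε / Λ ≤ 1 / 2 := by
      rw [div_le_iff₀ (by linarith)]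
      linarith
    have e2 : (ε / Λ) ^ 11 ≤ (1 / 2) ^ 10 * (ε / Λ) := by
      rw [pow_succ]
      gcongr
    have e3 : ε / Λ ≤ 2 * ε := by
      rw [div_le_iff₀ (by linarith)]
      nlinarith
    norm_num at e2
    linarith
  obtain ⟨d, g, hd, hg, hgl⟩ := exists_coin_neg_log h0 h1 l hl
  rw [← hΛ] at hg hgl
  have hZ0 : 0 < 2 * Λ + 18 := by linarith
  -- The normalization Z = 2Λ + 18 is at most 38Λ because Λ > 1/2; the offset Λ + 1 is that of the
  -- logarithmic coin.
  refine ⟨d, fun z => 1 / (2 * Λ + 18) * g z, 2 * Λ + 18, Λ + 1, by linarith, by linarith, ?_,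
    ?_, ?_⟩
  · have e1 : 1024 * l / γ ≤ 1024 * (13 * L) / γ := by gcongr
    have e2 : 1 ≤ 2 * L / γ := by
      rw [le_div_iff₀ h0]
      linarith
    have e3 : 30000 * L / γ = 2 * (1024 * (13 * L) / γ) + 1688 * (2 * L / γ) := by ring
    rw [e3]
    linarith
  · have := hg.const_mul (c := 1 / (2 * Λ + 18)) (by positivity)
    rwa [one_div_mul_cancel hZ0.ne'] at this
  · intro ρ h hρ hγ
    have e := coinProb_affine h (sum_eigenvalues_eq_one hρ h) g (1 / (2 * Λ + 18)) 0
    simp only [add_zero] at e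
    rw [e, ← mul_assoc, mul_one_div_cancel hZ0.ne', one_mul]
    refine (abs_coinProb_sub_entropy_le hρ hγ h fun z hz hz0 hz1 => ?_).trans hexp
    rw [← sub_sub]
    exact hgl z hz hz0 hz1

/-- If `log (1 / γ)` is small or the state is pure, a constant estimates the entropy. -/
theorem exists_const_estimate {γ ε : ℝ} (h0 : 0 < γ) (hε : 0 < ε)
    (h : Real.log (1 / γ) ≤ 2 * ε ∨ 1 / 2 < γ) :
    ∃ r : ℝ, ∀ ρ : Matrix (Qubits n) (Qubits n) ℂ, IsDensityMatrix ρ → NonzeroEigenvaluesGE ρ γ →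
      |r - vonNeumannEntropy ρ| ≤ ε := by
  rcases h with h | h
  · refine ⟨Real.log (1 / γ) / 2, fun ρ hρ hγ => ?_⟩
    have h1 := vonNeumannEntropy_nonneg hρ
    have h2 := vonNeumannEntropy_le h0 hρ hγ
    rw [abs_le]
    constructor <;> linarith
  · refine ⟨0, fun ρ hρ hγ => ?_⟩
    rw [vonNeumannEntropy_eq_zero h hρ hγ, sub_zero, abs_zero]
    exact hε.le

end QEntropy

theorem theorem5 (δ : ℝ) (hδ : 0 < δ) (hδ1 : δ < 1) :
    ∃ C : ℝ, 0 < C ∧ ∀ (n m : ℕ) (γ ε : ℝ), 0 < γ → γ ≤ 1 → 0 < ε →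
      (∃ P : QEntropy.SamplingAlgorithm n m,
        (P.queries : ℝ) ≤ C * (1 / (γ * ε ^ 2) * Real.log (1 / γ) ^ 2
          * Real.posLog (Real.log (1 / γ) / ε)) ∧
        ∀ (ρ : Matrix (QEntropy.Qubits n) (QEntropy.Qubits n) ℂ)
          (U : QEntropy.Unitaries (QEntropy.Qubits n × QEntropy.Qubits m)),
          QEntropy.IsDensityMatrix ρ → QEntropy.NonzeroEigenvaluesGE ρ γ →
          QEntropy.IsPurifiedQueryOracle U ρ →
          1 - δ ≤ P.outputProb U {E : ℝ | |E - QEntropy.vonNeumannEntropy ρ| ≤ ε}) ∧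
      (∃ P : QEntropy.AdaptiveAlgorithm n m,
        (P.queries : ℝ) ≤ C * (1 / (γ * ε) * Real.log (1 / γ)
          * Real.posLog (Real.log (1 / γ) / ε)) ∧
        ∀ (ρ : Matrix (QEntropy.Qubits n) (QEntropy.Qubits n) ℂ)
          (U : QEntropy.Unitaries (QEntropy.Qubits n × QEntropy.Qubits m)),
          QEntropy.IsDensityMatrix ρ → QEntropy.NonzeroEigenvaluesGE ρ γ →
          QEntropy.IsPurifiedQueryOracle U ρ →
          1 - δ ≤ P.outputProb U {E : ℝ | |E - QEntropy.vonNeumannEntropy ρ| ≤ ε}) := by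
  -- The constant exceeds both 5·38²·30000 and 108000·38·30000.
  refine ⟨10 ^ 12 / δ, by positivity, fun n m γ ε h0 h1 hε => ?_⟩
  set Λ := Real.log (1 / γ) with hΛ
  have hΛ0 : 0 ≤ Λ := Real.log_nonneg (by rw [le_div_iff₀ h0]; linarith)
  have hpos : 0 ≤ Real.posLog (Λ / ε) := Real.posLog_nonneg
  -- The case where the bound may vanish, handled without queries; otherwise Λ/ε > 2 and the
  -- positive logarithm is the logarithm.
  by_cases hc : Λ ≤ 2 * ε ∨ 1 / 2 < γ
  · obtain ⟨r, hr⟩ := QEntropy.exists_const_estimate (n := n) h0 hε hc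
    obtain ⟨P, hP, hP'⟩ := QEntropy.exists_sampling_of_const (m := m) hδ.le r hr
    obtain ⟨Q, hQ, hQ'⟩ := QEntropy.exists_adaptive_of_const (m := m) hδ.le r hr
    refine ⟨⟨P, ?_, hP'⟩, ⟨Q, ?_, hQ'⟩⟩
    · rw [hP, Nat.cast_zero]
      positivity
    · rw [hQ, Nat.cast_zero]
      positivity
  · push Not at hc
    obtain ⟨d, g, Z, a, hZ, hZΛ, hd, hg, hgS⟩ :=
      QEntropy.exists_entropyCoin (n := n) h0 hc.2 hε hc.1
    rw [← hΛ] at hZΛ hd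
    have hL : Real.posLog (Λ / ε) = Real.log (Λ / ε) := by
      refine Real.posLog_eq_log ?_
      rw [abs_of_nonneg (by positivity), le_div_iff₀ hε]
      linarith [hc.1]
    rw [hL] at hpos ⊢
    set L := Real.log (Λ / ε)
    have hZ0 : 0 < Z := hε.trans_le hZ
    obtain ⟨P, hP, hP'⟩ := QEntropy.exists_sampling_of_coin (m := m) hδ hδ1 hε hZ hg hgS
    obtain ⟨Q, hQ, hQ'⟩ := QEntropy.exists_adaptive_of_coin (m := m) hδ hδ1 hε hZ hg hgS
    refine ⟨⟨P, hP.trans ?_, hP'⟩, ⟨Q, hQ.trans ?_, hQ'⟩⟩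
    · calc 5 * Z ^ 2 / (δ * ε ^ 2) * (2 * d + 1)
          ≤ 5 * (38 * Λ) ^ 2 / (δ * ε ^ 2) * (30000 * L / γ) := by gcongr
        _ = 216600000 / δ * (1 / (γ * ε ^ 2) * Λ ^ 2 * L) := by
            field_simp
            ring
        _ ≤ 10 ^ 12 / δ * (1 / (γ * ε ^ 2) * Λ ^ 2 * L) := by
            gcongr
            norm_num
    · calc 108000 * Z / (δ * ε) * (2 * d + 1)
          ≤ 108000 * (38 * Λ) / (δ * ε) * (30000 * L / γ) := by gcongr
        _ = 123120000000 / δ * (1 / (γ * ε) * Λ * L) := by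
            field_simp
            ring
        _ ≤ 10 ^ 12 / δ * (1 / (γ * ε) * Λ * L) := by
            gcongr
            norm_num
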